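/- **Model.** A set cover instance consists of a finite universe $\mathcal E$ and a finite family $\mathcal S$ of subsets of $\mathcal E$ whose union is $\mathcal E$. A cover is a subfamily $\mathcal C\subseteq\mathcal S$ whose union is $\mathcal E$, and $\mathsf{OPT}$ is the minimum cardinality of a cover. The instance is given as the bipartite graph between $\mathcal S$ and $\mathcal E$ (with an edge $Se$ iff $e\in S$), stored in adjacency lists; one *probe* names a vertex $v$ and an integer $i$ and returns the vertex at position $i$ of the adjacency list of $v$ (or reports that there is none). A local computation algorithm (LCA) is a deterministic adaptive procedure that has access to the instance only through probes, may read bits of a common random string of independent fair bits, and answers two kinds of queries: given a set $S\in\mathcal S$, whether $S$ belongs to the output cover; given an element $e\in\mathcal E$, a set of the output cover that contains $e$. No memory is kept between queries. **Theorem.** There are a constant $C$ and an LCA for set cover, which is told two integers $\Delta,f\ge 1$, with the following properties for all $\Delta,f\ge1$ and every instance in which every set has at most $\Delta$ elements and every element lies in at most $f$ sets (in particular when $\Delta$ is the maximum set size and $f$ the maximum element frequency). 1. For every value of the random string, the answers to all queries are consistent with one subfamily $\mathcal C\subseteq\mathcal S$, and $\mathcal C$ is a cover. 2. For every value of the random string,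 each query is answered with at most $2^{C(1+\log_2\Delta\cdot\log_2 f)}$ probes; for $\Delta,f\ge2$ this is $2^{O(\log\Delta\cdot\log f)}=f^{O(\log\Delta)}$. 3. In expectation over the random string, $\mathbb E\,|\mathcal C|\le C(1+\log_2\Delta)\cdot\mathsf{OPT}$; for $\Delta\ge2$ this is $O(\log\Delta)\cdot\mathsf{OPT}$. -/

import Mathlib

/-- A set cover instance `⟨𝒮, ℰ⟩`, stored as a bipartite graph in adjacency list representation.
The sets are `0, …, numSets - 1`, the elements are `0, …, numElems - 1`; each vertex has a
duplicate-free list of its neighbours in an arbitrary order. -/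
structure SetCoverInstance where
  numSets : ℕ
  numElems : ℕ
  /-- The adjacency list of a set: the elements it contains. -/
  setAdj : Fin numSets → List (Fin numElems)
  /-- The adjacency list of an element: the sets that contain it. -/
  elemAdj : Fin numElems → List (Fin numSets)
  setAdj_nodup : ∀ S, (setAdj S).Nodup
  elemAdj_nodup : ∀ e, (elemAdj e).Nodup
  /-- Both kinds of lists describe the same bipartite graph. -/
  mem_setAdj_iff : ∀ S e, e ∈ setAdj S ↔ S ∈ elemAdj e
  /-- The union of the sets is the whole universe. -/
  exists_mem : ∀ e, ∃ S, e ∈ setAdj S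

namespace SetCoverInstance

/-- The maximum size of a set. -/
def maxSetSize (I : SetCoverInstance) : ℕ :=
  Finset.univ.sup fun S : Fin I.numSets => (I.setAdj S).length

/-- The maximum number of sets that contain one element. -/
def maxFreq (I : SetCoverInstance) : ℕ :=
  Finset.univ.sup fun e : Fin I.numElems => (I.elemAdj e).length

/-- A subfamily is a cover if each element lies in one of its members. -/
def IsCover (I : SetCoverInstance) (𝒞 : Finset (Fin I.numSets)) : Prop :=
  ∀ e, ∃ S ∈ 𝒞, e ∈ I.setAdj S

/-- The minimum cardinality of a cover. -/
noncomputable def opt (I : SetCoverInstance) : ℕ :=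
  sInf {k | ∃ 𝒞 : Finset (Fin I.numSets), I.IsCover 𝒞 ∧ 𝒞.card = k}

end SetCoverInstance

/-- Names of the vertices of the bipartite graph: a set or an element, with its number. -/
inductive SetCoverVertex where
  | set (S : ℕ)
  | elem (e : ℕ)

/-- The input oracle: the number of the vertex at position `i` (counted from `0`) of the adjacency
list of `v`, or `none` if there is no such vertex or no such position. -/
def SetCoverInstance.oracle (I : SetCoverInstance) : SetCoverVertex → ℕ → Option ℕ
  | .set S, i => if h : S < I.numSets then ((I.setAdj ⟨S, h⟩)[i]?).map Fin.val else none
  | .elem e, i => if h : e < I.numElems then ((I.elemAdj ⟨e, h⟩)[i]?).map Fin.val else none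

/-- Deterministic adaptive procedures with oracle access to the input and to a common random
string of bits. A procedure stops with an output, or probes position `i` of the adjacency list of
`v`, or reads the `k`-th bit of the random string, and continues according to the answer.
It has no access to the instance except through probes. -/
inductive ProbeProc (α : Type) where
  | ret (a : α)
  | probe (v : SetCoverVertex) (i : ℕ) (next : Option ℕ → ProbeProc α)
  | readBit (k : ℕ) (next : Bool → ProbeProc α)

namespace ProbeProc

/-- The output on the instance `I` with random string `ω`. -/
def output {α : Type} (I : SetCoverInstance) (ω : ℕ → Bool) : ProbeProc α → α
  | ret a => a
  | probe v i next => (next (I.oracle v i)).output I ω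
  | readBit k next => (next (ω k)).output I ω

/-- The number of probes to the input made on the instance `I` with random string `ω`. -/
def numProbes {α : Type} (I : SetCoverInstance) (ω : ℕ → Bool) : ProbeProc α → ℕ
  | ret _ => 0
  | probe v i next => (next (I.oracle v i)).numProbes I ω + 1
  | readBit k next => (next (ω k)).numProbes I ω

end ProbeProc

/-- A local computation algorithm for set cover. Each query is answered by its own run, without
memory of other queries; the runs share only the input and the random string. -/
structure SetCoverLCA where
  /-- Given a set, does it belong to the cover? -/
  setQuery : ℕ → ProbeProc Bool
  /-- Given an element, name a set of the cover that contains it. -/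
  elemQuery : ℕ → ProbeProc ℕ

/-- The subfamily given by the answers to all set queries for a fixed random string. -/
def SetCoverLCA.cover (A : SetCoverLCA) (I : SetCoverInstance) (ω : ℕ → Bool) :
    Finset (Fin I.numSets) :=
  Finset.univ.filter fun S => (A.setQuery S).output I ω = true

/-- The law of the common random string: independent fair bits. -/
noncomputable def randomString : MeasureTheory.Measure (ℕ → Bool) :=
  MeasureTheory.Measure.infinitePi fun _ : ℕ => (PMF.uniformOfFintype Bool).toMeasure

/-! The algorithm simulates a randomised parallel greedy process whose state can be recomputed
locally. Put `L = ⌈log₂ Δ⌉` and `F = ⌈log₂ f⌉`. There are `L + 1` phases of `T = 4 * F + 9` rounds,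
and phase `k` aims at sets with about `2 ^ (L - k)` uncovered elements. In each phase a set first
volunteers with probability `2 ^ (-F)`. In each round it samples positions of its list to test
whether it has many active elements: success doubles the probability (up to `1`), failure divides it
by four. A set joins when it volunteers and passes its test. Volunteering means that a `B`-bit coin
is divisible by a power of two, so the events for different exponents are nested.

Probes. The state before a round depends on earlier tests, so evaluation is recursive. Round `m` is
charged `4 ^ m` units, and an evaluation in round `n` is cut off after about `budget n = 2 ^ 16 * 4
^ n` units. Hence for every random string the cost grows by at most a constant factor per round
(`numProbes_tableProc_le`), which gives `2 ^ O((L + 1) * (F + 1))` probes. The cutoff can make an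
element stall until the next phase, or a test fail wrongly; the analysis shows that both are rare.

Approximation. By a potential argument (`expect_potential_le`), an element uncovered at the start of
a phase sees at most `23` expected volunteers while it is active in the phase (`sum_load_le`). This
load bounds the probability of stalling (`sum_stalls_le`) and the number of joins (`EE_joined_le`).
On the other hand, each fixed set has in expectation at most `2 ^ (L - k)` uncovered elements at the
start of phase `k` (`EE_numUnc_le`): while it stays large its exponent drifts down until it joins.
Applied to the members of an optimal cover, this leaves at most `OPT * 2 ^ (L - k)` expected
uncovered elements. Phase `k` pays `2048 / 2 ^ (L - k)` per unit of load, so each phase adds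
`O(OPT)` sets. After the last phase at most `OPT` elements are expected to remain, and each takes
the first set of its list (`EE_card_le`).

Consistency holds for every random string because `assign` always names a set containing the element
and the cover consists of the assigned sets. If `Δ ≤ 1` or `f ≤ 1`, the product of the logarithms
vanishes and only `O(1)` probes are allowed; choosing the first set of each element is then already
optimal (`FirstSet`). -/

open scoped BigOperators

/-! ### Sequencing of probe procedures -/

namespace ProbeProc

/-- Run a procedure and continue according to its output. -/
def bind {α β : Type} : ProbeProc α → (α → ProbeProc β) → ProbeProc β
  | ret a, k => k a
  | probe v i next, k => probe v i fun r => (next r).bind k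
  | readBit j next, k => readBit j fun b => (next b).bind k

@[simp] theorem output_ret {α : Type} (I : SetCoverInstance) (ω : ℕ → Bool) (a : α) :
    (ret a).output I ω = a := rfl

@[simp] theorem output_probe {α : Type} (I : SetCoverInstance) (ω : ℕ → Bool) (v i)
    (next : Option ℕ → ProbeProc α) :
    (probe v i next).output I ω = (next (I.oracle v i)).output I ω := rfl

@[simp] theorem output_readBit {α : Type} (I : SetCoverInstance) (ω : ℕ → Bool) (k)
    (next : Bool → ProbeProc α) :
    (readBit k next).output I ω = (next (ω k)).output I ω := rfl

@[simp] theorem numProbes_ret {α : Type} (I : SetCoverInstance) (ω : ℕ → Bool) (a : α) :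
    (ret a).numProbes I ω = 0 := rfl

@[simp] theorem numProbes_probe {α : Type} (I : SetCoverInstance) (ω : ℕ → Bool) (v i)
    (next : Option ℕ → ProbeProc α) :
    (probe v i next).numProbes I ω = (next (I.oracle v i)).numProbes I ω + 1 := rfl

@[simp] theorem numProbes_readBit {α : Type} (I : SetCoverInstance) (ω : ℕ → Bool) (k)
    (next : Bool → ProbeProc α) :
    (readBit k next).numProbes I ω = (next (ω k)).numProbes I ω := rfl

@[simp] theorem output_bind {α β : Type} (I : SetCoverInstance) (ω : ℕ → Bool)
    (P : ProbeProc α) (k : α → ProbeProc β) :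
    (P.bind k).output I ω = (k (P.output I ω)).output I ω := by
  induction P with
  | ret a => rfl
  | probe v i next ih => exact ih _
  | readBit j next ih => exact ih _

@[simp] theorem numProbes_bind {α β : Type} (I : SetCoverInstance) (ω : ℕ → Bool)
    (P : ProbeProc α) (k : α → ProbeProc β) :
    (P.bind k).numProbes I ω = P.numProbes I ω + (k (P.output I ω)).numProbes I ω := by
  induction P with
  | ret a => simp [bind]
  | probe v i next ih => simp only [bind, numProbes_probe, output_probe, ih]; omega
  | readBit j next ih => simp only [bind, numProbes_readBit, output_readBit, ih]

end ProbeProc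

/-! ### Adjacency lists of numbers, total in the vertex, and the oracle as lookup in them. -/

namespace SetCoverInstance

/-- The sets that contain the element with number `e`. -/
def elemList (I : SetCoverInstance) (e : ℕ) : List ℕ :=
  if h : e < I.numElems then (I.elemAdj ⟨e, h⟩).map Fin.val else []

/-- The elements of the set with number `S`. -/
def setList (I : SetCoverInstance) (S : ℕ) : List ℕ :=
  if h : S < I.numSets then (I.setAdj ⟨S, h⟩).map Fin.val else []

theorem oracle_elem (I : SetCoverInstance) (e p : ℕ) :
    I.oracle (.elem e) p = (I.elemList e)[p]? := by
  by_cases h : e < I.numElems <;> simp [oracle, elemList, h]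

theorem oracle_set (I : SetCoverInstance) (S p : ℕ) :
    I.oracle (.set S) p = (I.setList S)[p]? := by
  by_cases h : S < I.numSets <;> simp [oracle, setList, h]

end SetCoverInstance

/-! ### The sparsified greedy process -/

namespace SparseGreedy

/-- `2 ^ L` bounds the set sizes, `2 ^ F` the element frequencies. -/
structure Params where
  L : ℕ
  F : ℕ

namespace Params

/-- The number of rounds of a phase. -/
def T (p : Params) : ℕ := 4 * p.F + 9

/-- The number of random bits of a random number. -/
def B (p : Params) : ℕ := p.F + 2 * p.T + p.L

/-- The total number of rounds. -/
def rounds (p : Params) : ℕ := (p.L + 1) * p.T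

/-- The number of random positions that a set inspects in round `n`. -/
def slots (p : Params) (n : ℕ) : ℕ := 2048 * 2 ^ (p.B - p.L + n / p.T)

theorem T_pos (p : Params) : 0 < p.T := by unfold T; omega

end Params

/-- The work budget of an evaluation in round `n`. -/
def budget (n : ℕ) : ℕ := 2 ^ 16 * 4 ^ n

/-- The state of an element: it takes part in the phase, it has dropped out until the next phase,
or it is covered by `S`. -/
inductive ElemStatus where
  | active
  | stalled
  | covered (S : ℕ)

namespace ElemStatus

/-- Does the element take part in the phase? -/
def isActive : ElemStatus → Bool
  | active => true
  | _ => false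

/-- Has the element no covering set yet? -/
def isUncovered : ElemStatus → Bool
  | covered _ => false
  | _ => true

/-- At the start of a phase the stalled elements become active again. -/
def refresh (p : Params) (n : ℕ) : ElemStatus → ElemStatus
  | stalled => if n % p.T = 0 then active else stalled
  | s => s

end ElemStatus

section Spec

variable (p : Params) (I : SetCoverInstance) (ρ : ℕ → ℕ → ℕ → ℕ) (H : ℕ → ℕ → Bool)

/-- The set `S` volunteers in round `n` with probability `2 ^ (-expo n)`; `H m S` tells whether
the test of round `m` found `S` to be large. -/
def expo (S : ℕ) : ℕ → ℕ
  | 0 => p.F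
  | n + 1 => if (n + 1) % p.T = 0 then p.F else if H n S then expo S n - 1 else expo S n + 2

/-- Follow the exponent `a` of `S` from round `m` over `d` rounds as long as the coin `c` can still
make `S` volunteer at the end; the work, and whether `S` joins the cover at the end. -/
def scanLevels (S c : ℕ) : ℕ → ℕ → ℕ → ℕ × Bool
  | 0, m, a => if 2 ^ a ∣ c then (4 ^ m, H m S) else (0, false)
  | d + 1, m, a =>
    if 2 ^ (a - (d + 1)) ∣ c then
      let r := scanLevels S c d (m + 1) (if H m S then a - 1 else a + 2)
      (4 ^ m + r.1, r.2)
    else (0, false)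

/-- The evaluation of `S` for round `n`. -/
def evalSet (n S : ℕ) : ℕ × Bool :=
  scanLevels H S (ρ n S 0) (n % p.T) (n - n % p.T) p.F

/-- An active element looks in round `n` for a set that joins, and stalls if this is too much
work. -/
def scanSets (n : ℕ) : List ℕ → ℕ → ElemStatus
  | [], _ => .active
  | S :: l, acc =>
    if acc ≤ budget n then
      if (evalSet p ρ H n S).2 then .covered S else scanSets n l (acc + (evalSet p ρ H n S).1)
    else .stalled

/-- The status of `e` before round `n`. -/
def status (e : ℕ) : ℕ → ElemStatus
  | 0 => .active
  | n + 1 => ElemStatus.refresh p (n + 1) <|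
      if (status e n).isActive then scanSets p ρ H n (I.elemList e) 0 else status e n

/-- The work to find the status of `e` before round `n`. -/
def elemWeight (e n : ℕ) : ℕ :=
  ∑ m ∈ Finset.range n, if (status p I ρ H e m).isActive then 4 ^ m else 0

/-- The set `S` inspects random positions until it finds an active element. -/
def scanSlots (n S : ℕ) : ℕ → ℕ → ℕ → Bool
  | 0, _, _ => false
  | k + 1, s, acc =>
    if acc ≤ budget n then
      match (I.setList S)[ρ n S (s + 1)]? with
      | none => scanSlots n S k (s + 1) acc
      | some e =>
        if (status p I ρ H e n).isActive then true
        else scanSlots n S k (s + 1) (acc + elemWeight p I ρ H e n)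
    else false

/-- The results of the tests of the first rounds. -/
def table : ℕ → ℕ → ℕ → Bool
  | 0 => fun _ _ => false
  | n + 1 => fun m S =>
    if m = n then scanSlots p I ρ (table n) n S (p.slots n) 0 0 else table n m S

/-- The set that covers `e` in the end. -/
def assign (e : ℕ) : ℕ :=
  match status p I ρ (table p I ρ p.rounds) e p.rounds with
  | .covered S => S
  | _ => (I.elemList e).headD 0

end Spec

/-! ### Its local evaluation -/

/-- The position in the random string of a bit of a random number. -/
def bitKey (n S i b : ℕ) : ℕ := Nat.pair n (Nat.pair S (Nat.pair i b))

/-- The random numbers that are written in the random string. -/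
def numbers (B : ℕ) (ω : ℕ → Bool) (n S i : ℕ) : ℕ :=
  ∑ b ∈ Finset.range B, (ω (bitKey n S i b)).toNat * 2 ^ b

/-- Read a random number. -/
def numberProc (n S i : ℕ) : ℕ → ProbeProc ℕ
  | 0 => .ret 0
  | b + 1 => .readBit (bitKey n S i b) fun x =>
      (numberProc n S i b).bind fun v => .ret (v + x.toNat * 2 ^ b)

section Procs

variable (p : Params) (f : ℕ) (H : ℕ → ℕ → ProbeProc Bool)

/-- Local evaluation of `scanLevels`. -/
def scanLevelsProc (S c : ℕ) : ℕ → ℕ → ℕ → ProbeProc (ℕ × Bool)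
  | 0, m, a => if 2 ^ a ∣ c then (H m S).bind fun b => .ret (4 ^ m, b) else .ret (0, false)
  | d + 1, m, a =>
    if 2 ^ (a - (d + 1)) ∣ c then
      (H m S).bind fun b =>
        (scanLevelsProc S c d (m + 1) (if b then a - 1 else a + 2)).bind fun r =>
          .ret (4 ^ m + r.1, r.2)
    else .ret (0, false)

/-- Local evaluation of `evalSet`. -/
def evalSetProc (n S : ℕ) : ProbeProc (ℕ × Bool) :=
  (numberProc n S 0 p.B).bind fun c => scanLevelsProc H S c (n % p.T) (n - n % p.T) p.F

/-- Local evaluation of `scanSets`, on the sets in `k` successive positions of a list. -/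
def scanSetsProc (n e : ℕ) : ℕ → ℕ → ℕ → ProbeProc ElemStatus
  | 0, _, _ => .ret .active
  | k + 1, i, acc => .probe (.elem e) i fun
    | none => .ret .active
    | some S =>
      if acc ≤ budget n then
        (evalSetProc p H n S).bind fun r =>
          if r.2 then .ret (.covered S) else scanSetsProc n e k (i + 1) (acc + r.1)
      else .ret .stalled

/-- Local evaluation of `status` and `elemWeight`. -/
def statusProc (e : ℕ) : ℕ → ProbeProc (ElemStatus × ℕ)
  | 0 => .ret (.active, 0)
  | n + 1 => (statusProc e n).bind fun r =>
      if r.1.isActive then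
        (scanSetsProc p H n e f 0 0).bind fun s => .ret (s.refresh p (n + 1), r.2 + 4 ^ n)
      else .ret (r.1.refresh p (n + 1), r.2)

/-- Local evaluation of `scanSlots`. -/
def scanSlotsProc (n S : ℕ) : ℕ → ℕ → ℕ → ProbeProc Bool
  | 0, _, _ => .ret false
  | k + 1, s, acc =>
    if acc ≤ budget n then
      (numberProc n S (s + 1) p.B).bind fun i => .probe (.set S) i fun
        | none => scanSlotsProc n S k (s + 1) acc
        | some e => (statusProc p f H e n).bind fun r =>
          if r.1.isActive then .ret true else scanSlotsProc n S k (s + 1) (acc + r.2)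
    else .ret false

/-- Local evaluation of `table`. -/
def tableProc : ℕ → ℕ → ℕ → ProbeProc Bool
  | 0 => fun _ _ => .ret false
  | n + 1 => fun m S =>
    if m = n then scanSlotsProc p f (tableProc n) n S (p.slots n) 0 0 else tableProc n m S

/-- Local evaluation of `assign`. -/
def assignProc (e : ℕ) : ProbeProc ℕ :=
  (statusProc p f (tableProc p f p.rounds) e p.rounds).bind fun r =>
    match r.1 with
    | .covered S => .ret S
    | _ => .probe (.elem e) 0 fun o => .ret (o.getD 0)

end Procs

/-! ### Correctness of the local evaluation -/

section Output

variable (p : Params) (f : ℕ) (I : SetCoverInstance) (ω : ℕ → Bool)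

theorem output_numberProc (n S i B : ℕ) :
    (numberProc n S i B).output I ω = numbers B ω n S i := by
  induction B with
  | zero => simp [numberProc, numbers]
  | succ b ih => simp [numberProc, ih, numbers, Finset.sum_range_succ]

theorem numProbes_numberProc (n S i B : ℕ) : (numberProc n S i B).numProbes I ω = 0 := by
  induction B with
  | zero => simp [numberProc]
  | succ b ih => simp [numberProc, ih]

variable {H : ℕ → ℕ → ProbeProc Bool} {h : ℕ → ℕ → Bool}

theorem output_scanLevelsProc
    (hH : ∀ m S, (H m S).output I ω = h m S) (S c d m a : ℕ) :
    (scanLevelsProc H S c d m a).output I ω = scanLevels h S c d m a := by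
  induction d generalizing m a with
  | zero => unfold scanLevelsProc scanLevels; split_ifs <;> simp [hH]
  | succ d ih =>
    unfold scanLevelsProc scanLevels
    by_cases hc : 2 ^ (a - (d + 1)) ∣ c
    · simp only [if_pos hc, ProbeProc.output_bind, hH, ih, ProbeProc.output_ret]
    · simp [hc]

theorem output_evalSetProc
    (hH : ∀ m S, (H m S).output I ω = h m S) (n S : ℕ) :
    (evalSetProc p H n S).output I ω = evalSet p (numbers p.B ω) h n S := by
  simp [evalSetProc, evalSet, output_numberProc, output_scanLevelsProc I ω hH]

/-- By `hk` the fuel `k` reaches the end of the adjacency list, so the probing loop never stops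
before the list scan does. -/
theorem output_scanSetsProc
    (hH : ∀ m S, (H m S).output I ω = h m S) (n e k i acc : ℕ) (hk : (I.elemList e).length ≤ i + k) :
    (scanSetsProc p H n e k i acc).output I ω =
      scanSets p (numbers p.B ω) h n ((I.elemList e).drop i) acc := by
  induction k generalizing i acc with
  | zero =>
    rw [List.drop_eq_nil_of_le (by simpa using hk)]
    rfl
  | succ k ih =>
    simp only [scanSetsProc, ProbeProc.output_probe, I.oracle_elem]
    by_cases hi : i < (I.elemList e).length
    · rw [List.getElem?_eq_getElem hi, List.drop_eq_getElem_cons hi]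
      simp only [scanSets]
      by_cases ha : acc ≤ budget n
      · simp only [ha, if_true, ProbeProc.output_bind, output_evalSetProc p I ω hH]
        split_ifs
        · rfl
        · exact ih _ _ (by omega)
      · simp [ha]
    · rw [List.getElem?_eq_none (by omega), List.drop_eq_nil_of_le (by omega)]
      rfl

theorem output_statusProc
    (hH : ∀ m S, (H m S).output I ω = h m S) (e n : ℕ) (hf : (I.elemList e).length ≤ f) :
    (statusProc p f H e n).output I ω =
      (status p I (numbers p.B ω) h e n, elemWeight p I (numbers p.B ω) h e n) := by
  induction n with
  | zero => simp [statusProc, status, elemWeight]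
  | succ n ih =>
    have := output_scanSetsProc p I ω hH n e f 0 0 (by simpa using hf)
    simp only [statusProc, ProbeProc.output_bind, ih, status, elemWeight, Finset.sum_range_succ]
    split_ifs <;> simp [this]

theorem output_scanSlotsProc
    (hH : ∀ m S, (H m S).output I ω = h m S) (n S k s acc : ℕ) (hf : ∀ e, (I.elemList e).length ≤ f) :
    (scanSlotsProc p f H n S k s acc).output I ω =
      scanSlots p I (numbers p.B ω) h n S k s acc := by
  induction k generalizing s acc with
  | zero => rfl
  | succ k ih =>
    simp only [scanSlotsProc, scanSlots]
    by_cases ha : acc ≤ budget n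
    · simp only [ha, if_true, ProbeProc.output_bind, ProbeProc.output_probe, output_numberProc,
        I.oracle_set]
      cases (I.setList S)[numbers p.B ω n S (s + 1)]? with
      | none => exact ih _ _
      | some e =>
        simp only [ProbeProc.output_bind, output_statusProc p f I ω hH e n (hf e)]
        split_ifs
        · rfl
        · exact ih _ _
    · simp [ha]

theorem output_tableProc (hf : ∀ e, (I.elemList e).length ≤ f) (n m S : ℕ) :
    (tableProc p f n m S).output I ω = table p I (numbers p.B ω) n m S := by
  induction n generalizing m S with
  | zero => rfl
  | succ n ih =>
    simp only [tableProc, table]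
    split_ifs
    · exact output_scanSlotsProc p f I ω ih _ _ _ _ _ hf
    · exact ih _ _

theorem output_assignProc (hf : ∀ e, (I.elemList e).length ≤ f) (e : ℕ) :
    (assignProc p f e).output I ω = assign p I (numbers p.B ω) e := by
  simp only [assignProc, ProbeProc.output_bind, assign,
    output_statusProc p f I ω (output_tableProc p f I ω hf p.rounds) e _ (hf e)]
  cases status p I (numbers p.B ω) (table p I (numbers p.B ω) p.rounds) e p.rounds <;>
    simp [I.oracle_elem, List.head?_eq_getElem?, List.headD_eq_head?_getD]

end Output
end SparseGreedy

namespace SparseGreedy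

/-! ### Probe bounds -/

section Work

variable (p : Params) (I : SetCoverInstance) (ρ : ℕ → ℕ → ℕ → ℕ) (H : ℕ → ℕ → Bool)

/-- The levels cost at most `4 ^ m, …, 4 ^ (m + d)`, a geometric sum dominated by its last term. The
spare summand `4 ^ m` makes the induction close. -/
theorem scanLevels_fst_add_le (S c d m a : ℕ) :
    (scanLevels H S c d m a).1 + 4 ^ m ≤ 2 * 4 ^ (m + d) := by
  induction d generalizing m a with
  | zero => unfold scanLevels; (split_ifs <;> simp); omega
  | succ d ih =>
    unfold scanLevels
    by_cases hc : 2 ^ (a - (d + 1)) ∣ c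
    · have := ih (m + 1) (if H m S then a - 1 else a + 2)
      rw [show m + 1 + d = m + (d + 1) by ring] at this
      have h4 : 4 ^ (m + 1) = 4 * 4 ^ m := by ring
      simp only [hc, if_true]
      omega
    · have : 4 ^ m ≤ 4 ^ (m + (d + 1)) := Nat.pow_le_pow_right (by norm_num) (by omega)
      simp only [hc, if_false]
      omega

theorem evalSet_fst_le (n S : ℕ) : (evalSet p ρ H n S).1 ≤ 2 * 4 ^ n := by
  have := scanLevels_fst_add_le H S (ρ n S 0) (n % p.T) (n - n % p.T) p.F
  rw [Nat.sub_add_cancel (Nat.mod_le _ _)] at this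
  exact le_trans (Nat.le_add_right _ _) this

theorem elemWeight_le (e n : ℕ) : elemWeight p I ρ H e n ≤ 4 ^ n := by
  induction n with
  | zero => simp [elemWeight]
  | succ n ih =>
    have : elemWeight p I ρ H e (n + 1) ≤ elemWeight p I ρ H e n + 4 ^ n := by
      unfold elemWeight
      rw [Finset.sum_range_succ]
      gcongr
      split_ifs <;> simp
    have h4 : 4 ^ (n + 1) = 4 * 4 ^ n := by ring
    omega

end Work

section Probes

variable (p : Params) (f : ℕ) (I : SetCoverInstance) (ω : ℕ → Bool)
variable {H : ℕ → ℕ → ProbeProc Bool} {h : ℕ → ℕ → Bool}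

theorem numProbes_scanLevelsProc_le (hH : ∀ m S, (H m S).output I ω = h m S) {X n : ℕ}
    (hX : ∀ m ≤ n, ∀ S, (H m S).numProbes I ω ≤ 4 ^ m * X) (S c d m a : ℕ) (hm : m + d ≤ n) :
    (scanLevelsProc H S c d m a).numProbes I ω ≤ (scanLevels h S c d m a).1 * X := by
  induction d generalizing m a with
  | zero =>
    unfold scanLevelsProc scanLevels
    split_ifs
    · simpa using hX m (by omega) S
    · simp
  | succ d ih =>
    unfold scanLevelsProc scanLevels
    by_cases hc : 2 ^ (a - (d + 1)) ∣ c
    · simp only [if_pos hc, ProbeProc.numProbes_bind, ProbeProc.numProbes_ret, hH, add_zero, add_mul]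
      exact Nat.add_le_add (hX m (by omega) S) (ih _ _ (by omega))
    · simp [hc]

theorem numProbes_evalSetProc_le (hH : ∀ m S, (H m S).output I ω = h m S) {X n : ℕ}
    (hX : ∀ m ≤ n, ∀ S, (H m S).numProbes I ω ≤ 4 ^ m * X) (S : ℕ) :
    (evalSetProc p H n S).numProbes I ω ≤ (evalSet p (numbers p.B ω) h n S).1 * X := by
  simp only [evalSetProc, evalSet, ProbeProc.numProbes_bind, numProbes_numberProc,
    output_numberProc, zero_add]
  exact numProbes_scanLevelsProc_le I ω hH hX _ _ _ _ _
    (Nat.sub_add_cancel (Nat.mod_le _ _)).le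

/-- Amortisation: `X` is the price in probes of one unit of work, and `acc * X` is what has already
been paid. The cutoff is checked before each evaluation, so the budget is overshot by at most one
evaluation, that is by `2 * 4 ^ n`; the term `k` pays for reading the list. -/
theorem numProbes_scanSetsProc_le (hH : ∀ m S, (H m S).output I ω = h m S) {X n : ℕ}
    (hX : ∀ m ≤ n, ∀ S, (H m S).numProbes I ω ≤ 4 ^ m * X) (e k i acc : ℕ)
    (ha : acc ≤ budget n + 2 * 4 ^ n) :
    (scanSetsProc p H n e k i acc).numProbes I ω + acc * X ≤ k + (budget n + 2 * 4 ^ n) * X := by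
  induction k generalizing i acc with
  | zero =>
    simp only [scanSetsProc, ProbeProc.numProbes_ret]
    gcongr
  | succ k ih =>
    have hacc : acc * X ≤ (budget n + 2 * 4 ^ n) * X := by gcongr
    simp only [scanSetsProc, ProbeProc.numProbes_probe, I.oracle_elem]
    cases (I.elemList e)[i]? with
    | none => simp only [ProbeProc.numProbes_ret]; omega
    | some S =>
      by_cases hb : acc ≤ budget n
      · simp only [hb, if_true, ProbeProc.numProbes_bind, output_evalSetProc p I ω hH]
        have h1 := numProbes_evalSetProc_le p I ω hH hX S
        have h2 := evalSet_fst_le p (numbers p.B ω) h n S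
        have h4 : acc + (evalSet p (numbers p.B ω) h n S).1 ≤ budget n + 2 * 4 ^ n := by omega
        have h3 := ih (i + 1) (acc + (evalSet p (numbers p.B ω) h n S).1) h4
        have h5 := Nat.mul_le_mul_right X h4
        rw [add_mul] at h3 h5
        split_ifs
        · simp only [ProbeProc.numProbes_ret]; omega
        · omega
      · simp only [hb, if_false, ProbeProc.numProbes_ret]; omega

theorem numProbes_statusProc_le (hH : ∀ m S, (H m S).output I ω = h m S) {Y n : ℕ}
    (hY : ∀ m < n, ∀ e, (scanSetsProc p H m e f 0 0).numProbes I ω ≤ 4 ^ m * Y) (e : ℕ)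
    (hf : (I.elemList e).length ≤ f) :
    (statusProc p f H e n).numProbes I ω ≤ elemWeight p I (numbers p.B ω) h e n * Y := by
  induction n with
  | zero => simp [statusProc]
  | succ n ih =>
    have h1 := ih fun m hm => hY m (by omega)
    have h2 := hY n (by omega) e
    simp only [statusProc, ProbeProc.numProbes_bind, output_statusProc p f I ω hH e n hf]
    unfold elemWeight at h1 ⊢
    rw [Finset.sum_range_succ, add_mul]
    refine Nat.add_le_add h1 ?_
    split_ifs
    · simpa using h2
    · simp

theorem numProbes_scanSlotsProc_le (hH : ∀ m S, (H m S).output I ω = h m S) {Y n : ℕ}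
    (hY : ∀ m < n, ∀ e, (scanSetsProc p H m e f 0 0).numProbes I ω ≤ 4 ^ m * Y)
    (hf : ∀ e, (I.elemList e).length ≤ f) (S k s acc : ℕ) (ha : acc ≤ budget n + 4 ^ n) :
    (scanSlotsProc p f H n S k s acc).numProbes I ω + acc * Y ≤ k + (budget n + 4 ^ n) * Y := by
  induction k generalizing s acc with
  | zero =>
    simp only [scanSlotsProc, ProbeProc.numProbes_ret]
    gcongr
  | succ k ih =>
    have hacc : acc * Y ≤ (budget n + 4 ^ n) * Y := by gcongr
    simp only [scanSlotsProc]
    by_cases hb : acc ≤ budget n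
    · simp only [hb, if_true, ProbeProc.numProbes_bind, numProbes_numberProc,
        ProbeProc.numProbes_probe, output_numberProc, I.oracle_set]
      cases (I.setList S)[numbers p.B ω n S (s + 1)]? with
      | none =>
        have := ih (s + 1) acc ha
        simp only
        omega
      | some e =>
        simp only [ProbeProc.numProbes_bind, output_statusProc p f I ω hH e n (hf e)]
        have h1 := numProbes_statusProc_le p f I ω hH hY e (hf e)
        have h2 := elemWeight_le p I (numbers p.B ω) h e n
        have h4 : acc + elemWeight p I (numbers p.B ω) h e n ≤ budget n + 4 ^ n := by omega
        have h3 := ih (s + 1) _ h4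
        have h5 := Nat.mul_le_mul_right Y h4
        rw [add_mul] at h3 h5
        split_ifs
        · simp only [ProbeProc.numProbes_ret]; omega
        · omega
    · simp only [hb, if_false, ProbeProc.numProbes_ret]; omega

/-- A bound for the work in a test of round `0`. -/
def baseCost (p : Params) (f : ℕ) : ℕ := 2 * 2048 * 2 ^ p.B + f

theorem slots_le (n : ℕ) : p.slots n ≤ 2048 * 2 ^ p.B * 2 ^ n := by
  unfold Params.slots
  rw [mul_assoc, ← pow_add]
  have : n / p.T ≤ n := Nat.div_le_self _ _
  gcongr <;> omega

/-- The factor by which the work grows from a round to the next, up to the factor `4` of the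
budget. -/
def growth : ℕ := 2 ^ 34

theorem numProbes_scanSetsProc_le_pow (hH : ∀ m S, (H m S).output I ω = h m S)
    (hX : ∀ m S, (H m S).numProbes I ω ≤ 4 ^ m * (baseCost p f * growth ^ m)) (n e : ℕ) :
    (scanSetsProc p H n e f 0 0).numProbes I ω ≤
      4 ^ n * ((2 ^ 16 + 3) * (baseCost p f * growth ^ n)) := by
  have hX' : ∀ m ≤ n, ∀ S, (H m S).numProbes I ω ≤ 4 ^ m * (baseCost p f * growth ^ n) :=
    fun m hm S => (hX m S).trans (by gcongr; simp [growth])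
  have h1 := numProbes_scanSetsProc_le p I ω hH hX' e f 0 0 (Nat.zero_le _)
  have h2 : f ≤ 4 ^ n * (baseCost p f * growth ^ n) := by
    have : f ≤ baseCost p f := Nat.le_add_left _ _
    calc f ≤ 1 * (baseCost p f * 1) := by omega
      _ ≤ _ := by gcongr <;> exact Nat.one_le_pow _ _ (by simp [growth])
  have h3 : f + (budget n + 2 * 4 ^ n) * (baseCost p f * growth ^ n) ≤
      4 ^ n * ((2 ^ 16 + 3) * (baseCost p f * growth ^ n)) := by
    unfold budget
    nlinarith [h2]
  omega

/-- A unit of work of an element costs `2 ^ 16 + 3` times a unit of a test of the same or an earlier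
round, and a test of the next round buys about `2 ^ 16 * 4 ^ n` such units. The constant factors
multiply to at most `growth` per round. -/
theorem numProbes_tableProc_le (hf : ∀ e, (I.elemList e).length ≤ f) (n m S : ℕ) :
    (tableProc p f n m S).numProbes I ω ≤ 4 ^ m * (baseCost p f * growth ^ m) := by
  induction n generalizing m S with
  | zero => simp [tableProc]
  | succ n ih =>
    simp only [tableProc]
    split_ifs with hm
    · subst hm
      have hH := output_tableProc p f I ω hf m
      cases m with
      | zero =>
        -- No round precedes round `0`, so a unit of work has price `0` and only the slots
        -- themselves are paid for.
        have := numProbes_scanSlotsProc_le p f I ω hH (Y := 0) (n := 0) (by simp) hf S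
          (p.slots 0) 0 0 (by simp)
        have h2 := slots_le p 0
        simp only [baseCost, pow_zero, mul_one, one_mul] at h2 ⊢
        omega
      | succ j =>
        have hY : ∀ m < j + 1, ∀ e, (scanSetsProc p (tableProc p f (j + 1)) m e f 0 0).numProbes I ω
            ≤ 4 ^ m * ((2 ^ 16 + 3) * (baseCost p f * growth ^ j)) := fun m hm e =>
          (numProbes_scanSetsProc_le_pow p f I ω hH ih m e).trans (by
            gcongr
            · simp [growth]
            · omega)
        have h1 := numProbes_scanSlotsProc_le p f I ω hH hY hf S (p.slots (j + 1)) 0 0 (by simp)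
        have h2 := slots_le p (j + 1)
        -- The bound is split into halves: one for probing the slots, one (`h4`) for the work on
        -- elements.
        have h3 : 2 * (2048 * 2 ^ p.B * 2 ^ (j + 1)) ≤
            4 ^ (j + 1) * (baseCost p f * growth ^ (j + 1)) := by
          calc 2 * (2048 * 2 ^ p.B * 2 ^ (j + 1)) = 2 ^ (j + 1) * (2 * 2048 * 2 ^ p.B * 1) := by ring
            _ ≤ _ := by
              gcongr
              · norm_num
              · exact Nat.le_add_right _ _
              · exact Nat.one_le_pow _ _ (by simp [growth])
        have h4 : 2 * ((budget (j + 1) + 4 ^ (j + 1)) *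
            ((2 ^ 16 + 3) * (baseCost p f * growth ^ j))) ≤
            4 ^ (j + 1) * (baseCost p f * growth ^ (j + 1)) := by
          have : growth ^ (j + 1) = 2 ^ 34 * growth ^ j := by rw [pow_succ, mul_comm]; rfl
          rw [this]
          calc _ = (2 * (2 ^ 16 + 1) * (2 ^ 16 + 3)) *
                (4 ^ (j + 1) * (baseCost p f * growth ^ j)) := by unfold budget; ring
            _ ≤ 2 ^ 34 * (4 ^ (j + 1) * (baseCost p f * growth ^ j)) := by
              gcongr; norm_num
            _ = _ := by ring
        omega
    · exact ih m S

theorem numProbes_assignProc_le (hf : ∀ e, (I.elemList e).length ≤ f) (e : ℕ) :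
    (assignProc p f e).numProbes I ω ≤
      4 ^ p.rounds * ((2 ^ 16 + 3) * (baseCost p f * growth ^ p.rounds)) + 1 := by
  have hH := output_tableProc p f I ω hf p.rounds
  have hY : ∀ m < p.rounds, ∀ e,
      (scanSetsProc p (tableProc p f p.rounds) m e f 0 0).numProbes I ω
        ≤ 4 ^ m * ((2 ^ 16 + 3) * (baseCost p f * growth ^ p.rounds)) := fun m hm e =>
    (numProbes_scanSetsProc_le_pow p f I ω hH (numProbes_tableProc_le p f I ω hf _) m e).trans
      (by gcongr; simp [growth])
  have h1 := numProbes_statusProc_le p f I ω hH hY e (hf e)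
  have h2 := elemWeight_le p I (numbers p.B ω) (table p I (numbers p.B ω) p.rounds) e p.rounds
  simp only [assignProc, ProbeProc.numProbes_bind]
  refine Nat.add_le_add (h1.trans (by gcongr)) ?_
  split <;> simp

end Probes
end SparseGreedy

namespace SparseGreedy

/-! ### Structure of the process -/

section Structure

variable (p : Params) (I : SetCoverInstance) (ρ : ℕ → ℕ → ℕ → ℕ) (H : ℕ → ℕ → Bool)

/-! ### The incidence lists. -/

theorem elemList_lt {e S : ℕ} (h : S ∈ I.elemList e) : S < I.numSets := by
  unfold SetCoverInstance.elemList at h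
  split_ifs at h
  · obtain ⟨a, -, rfl⟩ := List.mem_map.1 h
    exact a.2
  · simp at h

theorem setList_lt {S e : ℕ} (h : e ∈ I.setList S) : e < I.numElems := by
  unfold SetCoverInstance.setList at h
  split_ifs at h
  · obtain ⟨a, -, rfl⟩ := List.mem_map.1 h
    exact a.2
  · simp at h

theorem mem_setList_iff {S e : ℕ} : e ∈ I.setList S ↔ S ∈ I.elemList e := by
  constructor
  · intro h
    have he := setList_lt I h
    unfold SetCoverInstance.setList at h
    split_ifs at h with hS
    · obtain ⟨a, ha, rfl⟩ := List.mem_map.1 h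
      simp only [SetCoverInstance.elemList, he, dif_pos, List.mem_map]
      exact ⟨⟨S, hS⟩, (I.mem_setAdj_iff _ _).1 ha, rfl⟩
    · simp at h
  · intro h
    have hS := elemList_lt I h
    unfold SetCoverInstance.elemList at h
    split_ifs at h with he
    · obtain ⟨a, ha, rfl⟩ := List.mem_map.1 h
      simp only [SetCoverInstance.setList, hS, dif_pos, List.mem_map]
      exact ⟨⟨e, he⟩, (I.mem_setAdj_iff _ _).2 ha, rfl⟩
    · simp at h

theorem elemList_nodup (e : ℕ) : (I.elemList e).Nodup := by
  unfold SetCoverInstance.elemList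
  split_ifs
  · exact (I.elemAdj_nodup _).map Fin.val_injective
  · exact List.nodup_nil

theorem setList_nodup (S : ℕ) : (I.setList S).Nodup := by
  unfold SetCoverInstance.setList
  split_ifs
  · exact (I.setAdj_nodup _).map Fin.val_injective
  · exact List.nodup_nil

theorem elemList_ne_nil {e : ℕ} (he : e < I.numElems) : I.elemList e ≠ [] := by
  obtain ⟨S, hS⟩ := I.exists_mem ⟨e, he⟩
  have : (S : ℕ) ∈ I.elemList e := by
    simp only [SetCoverInstance.elemList, he, dif_pos, List.mem_map]
    exact ⟨S, (I.mem_setAdj_iff _ _).1 hS, rfl⟩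
  exact List.ne_nil_of_mem this

/-! #### Dependence on the random numbers -/

/-- The two families of random numbers agree on all rounds before `n`. -/
def Agree (n : ℕ) (ρ ρ' : ℕ → ℕ → ℕ → ℕ) : Prop :=
  ∀ m < n, ∀ S < I.numSets, ∀ i ≤ p.slots m, ρ m S i = ρ' m S i

theorem Agree.mono {n m : ℕ} {ρ ρ' : ℕ → ℕ → ℕ → ℕ} (h : Agree p I n ρ ρ') (hm : m ≤ n) :
    Agree p I m ρ ρ' := fun j hj => h j (hj.trans_le hm)

variable {ρ' : ℕ → ℕ → ℕ → ℕ} {H' : ℕ → ℕ → Bool}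

theorem scanLevels_congr {n S c : ℕ} (hH : ∀ m ≤ n, H m S = H' m S) (d m a : ℕ) (hm : m + d ≤ n) :
    scanLevels H S c d m a = scanLevels H' S c d m a := by
  induction d generalizing m a with
  | zero => simp only [scanLevels, hH m (by omega)]
  | succ d ih => simp only [scanLevels, hH m (by omega), ih (m + 1) _ (by omega)]

theorem expo_congr {n S : ℕ} (hH : ∀ m < n, H m S = H' m S) : expo p H S n = expo p H' S n := by
  induction n with
  | zero => rfl
  | succ n ih => simp only [expo, hH n (by omega), ih fun m hm => hH m (by omega)]

theorem scanSets_congr {n : ℕ} (l : List ℕ) (hl : ∀ S ∈ l, evalSet p ρ H n S = evalSet p ρ' H' n S)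
    (acc : ℕ) : scanSets p ρ H n l acc = scanSets p ρ' H' n l acc := by
  induction l generalizing acc with
  | nil => rfl
  | cons S l ih =>
    simp only [scanSets, hl S (by simp), ih fun S' hS' => hl S' (by simp [hS'])]

theorem status_congr {n : ℕ} (hρ : Agree p I n ρ ρ')
    (hH : ∀ m < n, ∀ S < I.numSets, H m S = H' m S) (e : ℕ) {m : ℕ} (hm : m ≤ n) :
    status p I ρ H e m = status p I ρ' H' e m := by
  induction m with
  | zero => rfl
  | succ m ih =>
    have : scanSets p ρ H m (I.elemList e) 0 = scanSets p ρ' H' m (I.elemList e) 0 := by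
      refine scanSets_congr p ρ H _ (fun S hS => ?_) 0
      have hS' := elemList_lt I hS
      rw [evalSet, hρ m (by omega) S hS' 0 (Nat.zero_le _)]
      exact scanLevels_congr _ (n := m) (fun j hj => hH j (by omega) S hS') _ _ _
        (Nat.sub_add_cancel (Nat.mod_le _ _)).le
    simp only [status, this, ih (by omega)]

theorem elemWeight_congr {n : ℕ} (hρ : Agree p I n ρ ρ')
    (hH : ∀ m < n, ∀ S < I.numSets, H m S = H' m S) (e : ℕ) {m : ℕ} (hm : m ≤ n) :
    elemWeight p I ρ H e m = elemWeight p I ρ' H' e m := by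
  unfold elemWeight
  refine Finset.sum_congr rfl fun j hj => ?_
  rw [status_congr p I ρ H hρ hH e (by have := Finset.mem_range.1 hj; omega)]

/-- In round `n` only the indices `i ≥ 1` of `S` itself matter. Index `0` is the coin, and this is
the source of the independence of coin and test and of the tests of different sets. -/
theorem scanSlots_congr {n S : ℕ} (hρ : Agree p I n ρ ρ')
    (hH : ∀ m < n, ∀ S < I.numSets, H m S = H' m S) (k s acc : ℕ)
    (hs : ∀ i, 1 ≤ i → i ≤ s + k → ρ n S i = ρ' n S i) :
    scanSlots p I ρ H n S k s acc = scanSlots p I ρ' H' n S k s acc := by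
  induction k generalizing s acc with
  | zero => rfl
  | succ k ih =>
    have hs' : ∀ i, 1 ≤ i → i ≤ s + 1 + k → ρ n S i = ρ' n S i :=
      fun i hi hi' => hs i hi (by omega)
    simp only [scanSlots, hs (s + 1) (by omega) (by omega), ih _ _ hs', status_congr p I ρ H hρ hH _ le_rfl,
      elemWeight_congr p I ρ H hρ hH _ le_rfl]

/-- The test of round `n`: is `S` large? -/
def hi (n S : ℕ) : Bool := table p I ρ (n + 1) n S

theorem table_eq_hi {n m : ℕ} (hm : m < n) (S : ℕ) : table p I ρ n m S = hi p I ρ m S := by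
  induction n with
  | zero => omega
  | succ n ih =>
    rcases Nat.lt_succ_iff_lt_or_eq.1 hm with h | rfl
    · simp only [table, if_neg h.ne, ih h]
    · rfl

theorem Agree.refl (n : ℕ) (ρ : ℕ → ℕ → ℕ → ℕ) : Agree p I n ρ ρ := fun _ _ _ _ _ _ => rfl

/-- The fixed-point form of the recursion: the right side mentions `hi` itself, but a test of round
`n` consults tests of earlier rounds only. -/
theorem hi_eq (n S : ℕ) :
    hi p I ρ n S = scanSlots p I ρ (hi p I ρ) n S (p.slots n) 0 0 := by
  simp only [hi, table, if_true]
  exact scanSlots_congr p I ρ _ (Agree.refl p I n ρ) (fun m hm S _ => table_eq_hi p I ρ hm S)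
    _ _ _ fun _ _ _ => rfl

theorem hi_congr {n : ℕ} (hρ : Agree p I n ρ ρ') {m : ℕ} (hm : m < n) {S : ℕ}
    (hS : S < I.numSets) : hi p I ρ m S = hi p I ρ' m S := by
  induction m using Nat.strong_induction_on generalizing S with
  | _ m ih =>
    rw [hi_eq, hi_eq p I ρ']
    refine scanSlots_congr p I ρ _ (hρ.mono p I hm.le) (fun j hj S' hS' => ih j hj (by omega) hS')
      _ _ _ fun i _ hi => hρ m hm S hS i (by omega)

/-- The status of `e` before round `n`. -/
abbrev stat (e n : ℕ) : ElemStatus := status p I ρ (hi p I ρ) e n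

/-- The exponent of `S` in round `n`. -/
abbrev ex (S n : ℕ) : ℕ := expo p (hi p I ρ) S n

theorem stat_congr {n : ℕ} (hρ : Agree p I n ρ ρ') (e : ℕ) : stat p I ρ e n = stat p I ρ' e n :=
  status_congr p I ρ _ hρ (fun _ hm _ hS => hi_congr p I ρ hρ hm hS) e le_rfl

theorem ex_congr {n : ℕ} (hρ : Agree p I n ρ ρ') {S : ℕ} (hS : S < I.numSets) :
    ex p I ρ S n = ex p I ρ' S n :=
  expo_congr p _ fun _ hm => hi_congr p I ρ hρ hm hS

theorem assign_eq (e : ℕ) : assign p I ρ e =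
    match stat p I ρ e p.rounds with
    | .covered S => S
    | _ => (I.elemList e).headD 0 := by
  rw [assign, status_congr p I ρ _ (Agree.refl p I _ ρ) (fun m hm S _ => table_eq_hi p I ρ hm S)
    e le_rfl]

/-! #### Exponents -/

theorem expo_of_mod_eq_zero {n : ℕ} (hn : n % p.T = 0) (S : ℕ) : expo p H S n = p.F := by
  cases n with
  | zero => rfl
  | succ n => rw [expo, if_pos hn]

theorem succ_mod_T {n : ℕ} (hn : (n + 1) % p.T ≠ 0) : (n + 1) % p.T = n % p.T + 1 := by
  rw [Nat.add_mod_eq_ite, Nat.mod_eq_of_lt (show 1 < p.T by unfold Params.T; omega)]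
  split_ifs with h
  · exfalso
    apply hn
    have h2 : n % p.T < p.T := Nat.mod_lt _ p.T_pos
    rw [Nat.add_mod, Nat.mod_eq_of_lt (show 1 < p.T by unfold Params.T; omega),
      show n % p.T + 1 = p.T by omega, Nat.mod_self]
  · rfl

theorem expo_succ {n : ℕ} (hn : (n + 1) % p.T ≠ 0) (S : ℕ) :
    expo p H S (n + 1) = if H n S then expo p H S n - 1 else expo p H S n + 2 := by
  rw [expo, if_neg hn]

theorem expo_le (S n : ℕ) : expo p H S n ≤ p.F + 2 * (n % p.T) := by
  induction n with
  | zero => simp [expo]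
  | succ n ih =>
    by_cases hn : (n + 1) % p.T = 0
    · rw [expo_of_mod_eq_zero p H hn, hn]; omega
    · rw [expo_succ p H hn, succ_mod_T p hn]
      split_ifs <;> omega

theorem expo_le_B (S n : ℕ) : expo p H S n ≤ p.B := by
  have h1 := expo_le p H S n
  have h2 : n % p.T < p.T := Nat.mod_lt _ p.T_pos
  unfold Params.B
  omega

/-- The set `S` joins the cover in round `n`. -/
def Joined (n S : ℕ) : Prop := 2 ^ ex p I ρ S n ∣ ρ n S 0 ∧ hi p I ρ n S = true

/-- An exponent drops by at most one per round within a phase. So a coin not divisible by `2 ^ (a -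
d)` cannot make the set volunteer `d` rounds later, and the early exit of `scanLevels` loses
nothing. -/
theorem expo_sub_le {S m d : ℕ} (hd : m % p.T + d < p.T) :
    expo p H S m - d ≤ expo p H S (m + d) := by
  induction d with
  | zero => simp
  | succ d ih =>
    have h1 := ih (by omega)
    have h2 : (m + d + 1) % p.T ≠ 0 := by
      rw [show m + d + 1 = m + (d + 1) by ring, Nat.add_mod, Nat.mod_eq_of_lt (a := d + 1) (by omega),
        Nat.mod_eq_of_lt hd]
      omega
    rw [← add_assoc, expo_succ p H h2]
    split_ifs <;> omega

theorem scanLevels_snd_iff {S c : ℕ} (d m : ℕ) (hd : m % p.T + d < p.T) :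
    (scanLevels H S c d m (expo p H S m)).2 = true ↔
      2 ^ expo p H S (m + d) ∣ c ∧ H (m + d) S = true := by
  induction d generalizing m with
  | zero => unfold scanLevels; split_ifs <;> simp_all
  | succ d ih =>
    have hm : (m + 1) % p.T ≠ 0 := by
      rw [Nat.add_mod, Nat.mod_eq_of_lt (a := 1) (by omega), Nat.mod_eq_of_lt (by omega)]
      omega
    have h1 := ih (m + 1) (by rw [succ_mod_T p hm]; omega)
    have h2 := expo_sub_le p H (S := S) hd
    rw [expo_succ p H hm, show m + 1 + d = m + (d + 1) by ring] at h1
    unfold scanLevels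
    by_cases hc : 2 ^ (expo p H S m - (d + 1)) ∣ c
    · simp only [hc, if_true]
      exact h1
    · simp only [hc, if_false, Bool.false_eq_true, false_iff, not_and]
      intro h3
      exact absurd ((pow_dvd_pow 2 h2).trans h3) hc

/-- Here `j` counts rounds backwards from the last one. Level `m + d - j` is paid for only if the
coin survives the pruning test there, which becomes rarer the larger the exponent is. -/
theorem scanLevels_fst_le {S c : ℕ} (d m : ℕ) (hd : m % p.T + d < p.T) :
    (scanLevels H S c d m (expo p H S m)).1 ≤
      ∑ j ∈ Finset.range (d + 1),
        if 2 ^ (expo p H S (m + d - j) - j) ∣ c then 4 ^ (m + d - j) else 0 := by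
  induction d generalizing m with
  | zero => unfold scanLevels; split_ifs <;> simp_all
  | succ d ih =>
    have hm : (m + 1) % p.T ≠ 0 := by
      rw [Nat.add_mod, Nat.mod_eq_of_lt (a := 1) (by omega), Nat.mod_eq_of_lt (by omega)]
      omega
    have h1 := ih (m + 1) (by rw [succ_mod_T p hm]; omega)
    rw [expo_succ p H hm, show m + 1 + d = m + (d + 1) by ring] at h1
    unfold scanLevels
    rw [Finset.sum_range_succ, Nat.add_sub_cancel]
    by_cases hc : 2 ^ (expo p H S m - (d + 1)) ∣ c
    · simp only [hc, if_true]
      omega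
    · simp [hc]

theorem start_mod (n : ℕ) : (n - n % p.T) % p.T = 0 := by
  rw [Nat.sub_mod_eq_zero_of_mod_eq (by simp)]

theorem evalSet_snd_iff (n S : ℕ) :
    (evalSet p ρ (hi p I ρ) n S).2 = true ↔ Joined p I ρ n S := by
  have hs := start_mod p n
  have h := scanLevels_snd_iff p (hi p I ρ) (S := S) (c := ρ n S 0) (n % p.T) (n - n % p.T)
    (by rw [hs, zero_add]; exact Nat.mod_lt _ p.T_pos)
  rw [expo_of_mod_eq_zero p _ hs, Nat.sub_add_cancel (Nat.mod_le _ _)] at h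
  exact h

theorem evalSet_fst_le_sum (n S : ℕ) :
    (evalSet p ρ (hi p I ρ) n S).1 ≤ ∑ j ∈ Finset.range (n % p.T + 1),
      if 2 ^ (ex p I ρ S (n - j) - j) ∣ ρ n S 0 then 4 ^ (n - j) else 0 := by
  have hs := start_mod p n
  have h := scanLevels_fst_le p (hi p I ρ) (S := S) (c := ρ n S 0) (n % p.T) (n - n % p.T)
    (by rw [hs, zero_add]; exact Nat.mod_lt _ p.T_pos)
  rw [expo_of_mod_eq_zero p _ hs, Nat.sub_add_cancel (Nat.mod_le _ _)] at h
  exact h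

/-! #### The list scans -/

theorem scanSets_active {n : ℕ} {l : List ℕ} {acc : ℕ}
    (h : (scanSets p ρ H n l acc).isActive = true) : ∀ S ∈ l, (evalSet p ρ H n S).2 = false := by
  induction l generalizing acc with
  | nil => simp
  | cons S l ih =>
    rw [scanSets] at h
    split_ifs at h with h1 h2
    · simp [ElemStatus.isActive] at h
    · intro S' hS'
      rcases List.mem_cons.1 hS' with rfl | h'
      · simpa using h2
      · exact ih h S' h'
    · simp [ElemStatus.isActive] at h

theorem scanSets_covered {n : ℕ} {l : List ℕ} {acc S : ℕ}
    (h : scanSets p ρ H n l acc = .covered S) : S ∈ l ∧ (evalSet p ρ H n S).2 = true := by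
  induction l generalizing acc with
  | nil => simp [scanSets] at h
  | cons S' l ih =>
    rw [scanSets] at h
    split_ifs at h with h1 h2
    · obtain rfl : S' = S := by simpa using h
      exact ⟨by simp, h2⟩
    · exact ⟨by simp [(ih h).1], (ih h).2⟩

theorem scanSets_stalled {n : ℕ} {l : List ℕ} {acc : ℕ}
    (h : scanSets p ρ H n l acc = .stalled) :
    budget n < acc + (l.map fun S => (evalSet p ρ H n S).1).sum := by
  induction l generalizing acc with
  | nil => simp [scanSets] at h
  | cons S l ih =>
    rw [scanSets] at h
    rw [List.map_cons, List.sum_cons]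
    split_ifs at h with h1 h2
    · have := ih h
      omega
    · omega

theorem exists_of_scanSlots {n S k s acc : ℕ} (h : scanSlots p I ρ H n S k s acc = true) :
    ∃ j, s ≤ j ∧ j < s + k ∧ ∃ e, (I.setList S)[ρ n S (j + 1)]? = some e ∧
      (status p I ρ H e n).isActive = true := by
  induction k generalizing s acc with
  | zero => simp [scanSlots] at h
  | succ k ih =>
    rw [scanSlots] at h
    split_ifs at h with h1
    · cases he : (I.setList S)[ρ n S (s + 1)]? with
      | none =>
        rw [he] at h
        obtain ⟨j, hj, hj', e⟩ := ih h
        exact ⟨j, by omega, by omega, e⟩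
      | some e =>
        rw [he] at h
        simp only at h
        split_ifs at h with h2
        · exact ⟨s, le_rfl, by omega, e, he, h2⟩
        · obtain ⟨j, hj, hj', e⟩ := ih h
          exact ⟨j, by omega, by omega, e⟩

/-- The work for the position `i` of the set `S` in round `n`. -/
def posWeight (n S i : ℕ) : ℕ :=
  match (I.setList S)[i]? with
  | none => 0
  | some e => elemWeight p I ρ H e n

/-- The number `m` of slots to look at is free below `k`. The analysis takes it smaller than the
number of available slots, so that the expected work on these slots stays far below the budget. -/
theorem scanSlots_false {n S k s acc : ℕ} (h : scanSlots p I ρ H n S k s acc = false) (m : ℕ)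
    (hm : m ≤ k) : (∀ j, s ≤ j → j < s + m → ∀ e, (I.setList S)[ρ n S (j + 1)]? = some e →
      (status p I ρ H e n).isActive = false) ∨
      budget n < acc + ∑ j ∈ Finset.range m, posWeight p I ρ H n S (ρ n S (s + j + 1)) := by
  induction k generalizing s acc m with
  | zero => left; intro j; omega
  | succ k ih =>
    cases m with
    | zero => left; intro j; omega
    | succ m =>
      rw [scanSlots] at h
      rw [Finset.sum_range_succ']
      have hsh : ∀ j, s + (j + 1) + 1 = s + 1 + j + 1 := fun j => by ring
      simp only [hsh, add_zero]
      split_ifs at h with h1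
      · cases he : (I.setList S)[ρ n S (s + 1)]? with
        | none =>
          rw [he] at h
          rcases ih h m (by omega) with h2 | h2
          · left
            intro j hj hj' e hje
            rcases eq_or_lt_of_le hj with rfl | hj
            · rw [he] at hje; cases hje
            · exact h2 j hj (by omega) e hje
          · right; omega
        | some e =>
          rw [he] at h
          simp only at h
          split_ifs at h with h3
          rcases ih h m (by omega) with h2 | h2
          · left
            intro j hj hj' e' hje
            rcases eq_or_lt_of_le hj with rfl | hj
            · rw [he] at hje; cases hje; simpa using h3
            · exact h2 j hj (by omega) e' hje
          · right
            have : posWeight p I ρ H n S (ρ n S (s + 1)) = elemWeight p I ρ H e n := by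
              simp [posWeight, he]
            omega
      · right; omega

/-! #### The status of an element -/

theorem stat_succ (e n : ℕ) : stat p I ρ e (n + 1) = ElemStatus.refresh p (n + 1)
    (if (stat p I ρ e n).isActive then scanSets p ρ (hi p I ρ) n (I.elemList e) 0
      else stat p I ρ e n) := rfl

/-- The element `e` is active before round `n`. -/
abbrev Act (e n : ℕ) : Prop := (stat p I ρ e n).isActive = true

/-- The element `e` is not covered before round `n`. -/
abbrev Unc (e n : ℕ) : Prop := (stat p I ρ e n).isUncovered = true

/-- The element `e` gives up in round `n`. -/
def Stalls (e n : ℕ) : Prop :=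
  Act p I ρ e n ∧ scanSets p ρ (hi p I ρ) n (I.elemList e) 0 = .stalled

variable {p I ρ}

theorem Act.unc {e n : ℕ} (h : Act p I ρ e n) : Unc p I ρ e n := by
  revert h
  unfold Act Unc
  cases stat p I ρ e n <;> simp [ElemStatus.isActive, ElemStatus.isUncovered]

theorem Unc.act {e n : ℕ} (h : Unc p I ρ e n) (hn : n % p.T = 0) : Act p I ρ e n := by
  cases n with
  | zero => rfl
  | succ n =>
    unfold Unc at h
    unfold Act
    rw [stat_succ] at h ⊢
    revert h
    generalize (if (stat p I ρ e n).isActive then _ else _ : ElemStatus) = s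
    cases s <;> simp [ElemStatus.refresh, hn, ElemStatus.isActive, ElemStatus.isUncovered]

/-- An element stays active only if its scan reached the end of the list, hence no set containing it
joined. A stalled element carries no such information, and this is why stalling ends its
participation in the phase. -/
theorem Act.of_succ {e n : ℕ} (h : Act p I ρ e (n + 1)) (hn : (n + 1) % p.T ≠ 0) :
    Act p I ρ e n ∧ ∀ S ∈ I.elemList e, ¬ Joined p I ρ n S := by
  unfold Act at h
  rw [stat_succ] at h
  split_ifs at h with h1
  · refine ⟨h1, fun S hS => ?_⟩
    rw [← evalSet_snd_iff, Bool.not_eq_true]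
    refine scanSets_active p ρ _ (acc := 0) ?_ S hS
    revert h
    generalize scanSets p ρ (hi p I ρ) n (I.elemList e) 0 = s
    cases s <;> simp [ElemStatus.refresh, hn, ElemStatus.isActive]
  · exfalso
    revert h h1
    generalize stat p I ρ e n = s
    cases s <;> simp [ElemStatus.refresh, hn, ElemStatus.isActive]

theorem Unc.of_succ {e n : ℕ} (h : Unc p I ρ e (n + 1)) : Unc p I ρ e n := by
  by_cases h1 : Act p I ρ e n
  · exact h1.unc
  · unfold Unc at h ⊢
    rw [stat_succ, if_neg h1] at h
    revert h
    generalize stat p I ρ e n = s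
    cases s <;> simp [ElemStatus.refresh, ElemStatus.isUncovered]

theorem Unc.mono {e n m : ℕ} (h : Unc p I ρ e n) (hm : m ≤ n) : Unc p I ρ e m := by
  induction n with
  | zero => obtain rfl : m = 0 := by omega
            exact h
  | succ n ih =>
    rcases Nat.le_succ_iff.1 hm with h1 | rfl
    · exact ih h.of_succ h1
    · exact h

theorem Act.mono_phase {e k t t' : ℕ} (h : Act p I ρ e (k * p.T + t)) (ht : t < p.T)
    (ht' : t' ≤ t) : Act p I ρ e (k * p.T + t') := by
  induction t with
  | zero => obtain rfl : t' = 0 := by omega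
            exact h
  | succ t ih =>
    rcases Nat.le_succ_iff.1 ht' with h1 | rfl
    · rw [← add_assoc] at h
      refine ih (h.of_succ ?_).1 (by omega) h1
      rw [show k * p.T + t + 1 = t + 1 + k * p.T by ring, Nat.add_mul_mod_self_right,
        Nat.mod_eq_of_lt ht]
      omega
    · exact h

/-- Every uncovered element is active again at the start of a phase, so stalling in this very phase
is the only way to be uncovered and inactive. -/
theorem Unc.act_or_stalls {e k t : ℕ} (h : Unc p I ρ e (k * p.T + t)) (ht : t < p.T) :
    Act p I ρ e (k * p.T + t) ∨ ∃ s < t, Stalls p I ρ e (k * p.T + s) := by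
  induction t with
  | zero => exact .inl (h.act (by simp))
  | succ t ih =>
    have hmod : (k * p.T + t + 1) % p.T ≠ 0 := by
      rw [show k * p.T + t + 1 = t + 1 + k * p.T by ring, Nat.add_mul_mod_self_right,
        Nat.mod_eq_of_lt ht]
      omega
    rcases ih h.of_succ (by omega) with h1 | ⟨s, hs, h1⟩
    · rw [← add_assoc] at h ⊢
      unfold Unc at h
      rw [stat_succ, if_pos h1] at h
      unfold Act
      rw [stat_succ, if_pos h1]
      cases hs : scanSets p ρ (hi p I ρ) (k * p.T + t) (I.elemList e) 0 with
      | active => left; rfl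
      | stalled => right; exact ⟨t, by omega, h1, hs⟩
      | covered S => rw [hs] at h; simp [ElemStatus.refresh, ElemStatus.isUncovered] at h
    · exact .inr ⟨s, by omega, h1⟩

theorem exists_joined_of_covered {e n S : ℕ} (h : stat p I ρ e n = .covered S) :
    S ∈ I.elemList e ∧ ∃ m < n, Joined p I ρ m S := by
  induction n with
  | zero => simp [stat, status] at h
  | succ n ih =>
    rw [stat_succ] at h
    split_ifs at h with h1
    · have h2 : scanSets p ρ (hi p I ρ) n (I.elemList e) 0 = .covered S := by
        revert h
        generalize scanSets p ρ (hi p I ρ) n (I.elemList e) 0 = s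
        cases s <;> simp [ElemStatus.refresh]
        split_ifs <;> simp
      have h3 := scanSets_covered p ρ _ h2
      exact ⟨h3.1, n, by omega, (evalSet_snd_iff p I ρ n S).1 h3.2⟩
    · have h2 : stat p I ρ e n = .covered S := by
        revert h
        generalize stat p I ρ e n = s
        cases s <;> simp [ElemStatus.refresh]
        split_ifs <;> simp
      obtain ⟨h3, m, hm, h4⟩ := ih h2
      exact ⟨h3, m, by omega, h4⟩

theorem assign_mem {e : ℕ} (he : e < I.numElems) : assign p I ρ e ∈ I.elemList e := by
  rw [assign_eq]
  have : (I.elemList e).headD 0 ∈ I.elemList e := by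
    have := elemList_ne_nil I he
    cases h : I.elemList e with
    | nil => exact absurd h this
    | cons a l => simp
  split
  · next S h => exact (exists_joined_of_covered h).1
  · exact this

end Structure
end SparseGreedy

/-! ### Uniform averages -/

namespace SparseGreedy

-- Resampling one coordinate preserves the uniform average, since exchanging the old value with the
-- fresh one is an involution of the pairs. This replaces conditional expectation given the other
-- coordinates.
open Finset in
theorem expect_update {ι : Type*} {α : Type*} [Fintype ι] [DecidableEq ι] [Fintype α]
    [Nonempty α] (i : ι) (φ : (ι → α) → ℝ) :
    𝔼 x : ι → α, φ x = 𝔼 x : ι → α, 𝔼 a : α, φ (Function.update x i a) := by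
  have h1 : 𝔼 x : ι → α, φ x = 𝔼 z : (ι → α) × α, φ z.1 := by
    rw [← univ_product_univ, expect_product]
    simp
  have h2 : 𝔼 x : ι → α, 𝔼 a : α, φ (Function.update x i a) =
      𝔼 z : (ι → α) × α, φ (Function.update z.1 i z.2) := by
    rw [← univ_product_univ, expect_product]
  rw [h1, h2]
  let E : (ι → α) × α → (ι → α) × α := fun z => (Function.update z.1 i z.2, z.1 i)
  have hE : Function.Involutive E := by
    rintro ⟨x, a⟩
    simp [E]
  exact (Fintype.expect_equiv hE.toPerm _ _ fun z => by simp [E, Function.Involutive.toPerm]).symm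

open Finset in
theorem expect_prod_pi {ι : Type*} {α : Type*} [Fintype ι] [DecidableEq ι] [Fintype α]
    (g : ι → α → ℝ) : 𝔼 x : ι → α, ∏ i, g i (x i) = ∏ i, 𝔼 a, g i a := by
  simp only [Fintype.expect_eq_sum_div_card, prod_div_distrib, prod_const, Fintype.card_fun]
  rw [prod_univ_sum, Fintype.piFinset_univ]
  simp

theorem expect_eval {ι : Type*} {α : Type*} [Fintype ι] [DecidableEq ι] [Fintype α]
    [Nonempty α] (i : ι) (g : α → ℝ) : 𝔼 x : ι → α, g (x i) = 𝔼 a, g a := by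
  rw [expect_update i]
  simp

open Finset in
theorem expect_prod_subset {ι : Type*} {α : Type*} [Fintype ι] [DecidableEq ι] [Fintype α]
    [Nonempty α] (J : Finset ι) (g : ι → α → ℝ) :
    𝔼 x : ι → α, ∏ i ∈ J, g i (x i) = ∏ i ∈ J, 𝔼 a, g i a := by
  have := expect_prod_pi fun i a => if i ∈ J then g i a else 1
  rw [prod_congr rfl fun i _ => show (𝔼 a, if i ∈ J then g i a else 1) =
    if i ∈ J then 𝔼 a, g i a else 1 by split_ifs <;> simp] at this
  simpa [prod_ite_mem] using this

theorem expect_mono {α : Type*} [Fintype α] {φ ψ : α → ℝ} (h : ∀ a, φ a ≤ ψ a) :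
    𝔼 a, φ a ≤ 𝔼 a, ψ a := Finset.expect_le_expect fun a _ => h a

theorem expect_nonneg' {α : Type*} [Fintype α] {φ : α → ℝ} (h : ∀ a, 0 ≤ φ a) :
    0 ≤ 𝔼 a, φ a := Finset.expect_nonneg fun a _ => h a

/-- The indicator of a proposition. -/
noncomputable def ind (P : Prop) : ℝ := by
  classical exact if P then 1 else 0

theorem ind_of {P : Prop} (h : P) : ind P = 1 := by simp [ind, h]

theorem ind_of_not {P : Prop} (h : ¬ P) : ind P = 0 := by simp [ind, h]

theorem ind_nonneg (P : Prop) : 0 ≤ ind P := by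
  by_cases h : P <;> simp [ind, h]

theorem ind_le_one (P : Prop) : ind P ≤ 1 := by
  by_cases h : P <;> simp [ind, h]

theorem ind_mono {P Q : Prop} (h : P → Q) : ind P ≤ ind Q := by
  by_cases hP : P
  · rw [ind_of hP, ind_of (h hP)]
  · rw [ind_of_not hP]; exact ind_nonneg _

theorem ind_and (P Q : Prop) : ind (P ∧ Q) = ind P * ind Q := by
  by_cases hP : P <;> by_cases hQ : Q <;> simp [ind, hP, hQ]

theorem ind_not (P : Prop) : ind (¬ P) = 1 - ind P := by
  by_cases hP : P <;> simp [ind, hP]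

/-- Markov's inequality, pointwise. -/
theorem ind_lt_le_div {b x : ℝ} (hb : 0 < b) (hx : 0 ≤ x) : ind (b < x) ≤ x / b := by
  by_cases h : b < x
  · rw [ind_of h, le_div_iff₀ hb]; linarith
  · rw [ind_of_not h]; positivity

/-! ### The sample space -/

section Sample

variable (p : Params) (I : SetCoverInstance)

/-- The random numbers of one set in one round. -/
abbrev SetSample : Type := Fin (p.slots p.rounds + 1) → Fin (2 ^ p.B)

/-- The random numbers of one round. -/
abbrev RoundSample : Type := Fin I.numSets → SetSample p

/-- All random numbers. -/
abbrev Sample : Type := Fin p.rounds → RoundSample p I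

instance : Nonempty (Fin (2 ^ p.B)) := ⟨⟨0, by positivity⟩⟩

/-- The random number with index `i`. -/
def SetSample.val {p : Params} (ξ : SetSample p) (i : ℕ) : ℕ :=
  if h : i < p.slots p.rounds + 1 then ξ ⟨i, h⟩ else 0

/-- The random number of `S` with index `i`. -/
def RoundSample.val {p : Params} {I : SetCoverInstance} (r : RoundSample p I) (S i : ℕ) : ℕ :=
  if h : S < I.numSets then (r ⟨S, h⟩).val i else 0

/-- The random numbers of a sample point. -/
def Sample.val {p : Params} {I : SetCoverInstance} (x : Sample p I) (n S i : ℕ) : ℕ :=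
  if h : n < p.rounds then RoundSample.val (x ⟨n, h⟩) S i else 0

/-- Replace the random numbers of round `n`. -/
def splice {p : Params} {I : SetCoverInstance} (ρ : ℕ → ℕ → ℕ → ℕ) (n : ℕ) (r : RoundSample p I) :
    ℕ → ℕ → ℕ → ℕ :=
  Function.update ρ n r.val

theorem val_update (x : Sample p I) {n : ℕ} (hn : n < p.rounds) (r : RoundSample p I) :
    Sample.val (Function.update x ⟨n, hn⟩ r) = splice x.val n r := by
  funext m S i
  by_cases h : m = n
  · subst h
    simp [Sample.val, splice, hn]
  · simp only [Sample.val, splice, Function.update_of_ne h]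
    split_ifs with hm
    · rw [Function.update_of_ne (by simpa [Fin.ext_iff] using h)]
    · rfl

theorem agree_splice (ρ : ℕ → ℕ → ℕ → ℕ) (n : ℕ) (r : RoundSample p I) :
    Agree p I n (splice ρ n r) ρ := fun m hm S _ i _ => by
  rw [splice, Function.update_of_ne hm.ne]

theorem splice_self (ρ : ℕ → ℕ → ℕ → ℕ) (n : ℕ) (r : RoundSample p I) :
    splice ρ n r n = r.val := by
  simp [splice]

/-- The expectation over all random numbers. -/
noncomputable def EE (φ : (ℕ → ℕ → ℕ → ℕ) → ℝ) : ℝ := 𝔼 x : Sample p I, φ x.val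

theorem EE_step {n : ℕ} (hn : n < p.rounds) (φ : (ℕ → ℕ → ℕ → ℕ) → ℝ) :
    EE p I φ = EE p I fun ρ => 𝔼 r : RoundSample p I, φ (splice ρ n r) := by
  unfold EE
  rw [expect_update ⟨n, hn⟩]
  simp only [val_update]

theorem EE_mono {φ ψ : (ℕ → ℕ → ℕ → ℕ) → ℝ} (h : ∀ ρ, φ ρ ≤ ψ ρ) : EE p I φ ≤ EE p I ψ :=
  expect_mono fun _ => h _

/-- One round of a supermartingale estimate. -/
theorem EE_le_of_round {n : ℕ} (hn : n < p.rounds) {φ ψ : (ℕ → ℕ → ℕ → ℕ) → ℝ}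
    (h : ∀ ρ, 𝔼 r : RoundSample p I, φ (splice ρ n r) ≤ ψ ρ) : EE p I φ ≤ EE p I ψ := by
  rw [EE_step p I hn]
  exact EE_mono p I h

theorem EE_add (φ ψ : (ℕ → ℕ → ℕ → ℕ) → ℝ) :
    EE p I (fun ρ => φ ρ + ψ ρ) = EE p I φ + EE p I ψ := Finset.expect_add_distrib _ _ _

theorem EE_mul_left (c : ℝ) (φ : (ℕ → ℕ → ℕ → ℕ) → ℝ) :
    EE p I (fun ρ => c * φ ρ) = c * EE p I φ := (Finset.mul_expect _ _ _).symm

theorem EE_sum {ι : Type*} (s : Finset ι) (φ : ι → (ℕ → ℕ → ℕ → ℕ) → ℝ) :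
    EE p I (fun ρ => ∑ i ∈ s, φ i ρ) = ∑ i ∈ s, EE p I (φ i) := Finset.expect_sum_comm _ _ _

theorem EE_const (c : ℝ) : EE p I (fun _ => c) = c := by simp [EE]

theorem EE_nonneg {φ : (ℕ → ℕ → ℕ → ℕ) → ℝ} (h : ∀ ρ, 0 ≤ φ ρ) : 0 ≤ EE p I φ :=
  expect_nonneg' fun _ => h _

end Sample

/-! ### One round -/

theorem slots_mono (p : Params) {n m : ℕ} (h : n ≤ m) : p.slots n ≤ p.slots m := by
  unfold Params.slots
  have := Nat.div_le_div_right (c := p.T) h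
  gcongr
  norm_num

open Finset in
theorem sum_range_getElem? {α : Type*} (l : List α) (g : α → ℝ) {N : ℕ} (hN : l.length ≤ N) :
    ∑ i ∈ range N, (l[i]?).elim 0 g = (l.map g).sum := by
  induction l generalizing N with
  | nil => simp
  | cons a l ih =>
    obtain ⟨N, rfl⟩ : ∃ M, N = M + 1 := ⟨N - 1, by simp at hN; omega⟩
    rw [sum_range_succ']
    simp only [List.getElem?_cons_succ, List.getElem?_cons_zero, Option.elim_some, List.map_cons,
      List.sum_cons]
    rw [ih (by simpa using hN), add_comm]

-- A random index below `N` may lie beyond the end of the list; it then counts `0`, so each element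
-- is hit with probability exactly `1 / N`.
open Finset in
theorem expect_getElem? (l : List ℕ) (hl : l.Nodup) (g : ℕ → ℝ) {N : ℕ} (hN : l.length ≤ N) :
    𝔼 c : Fin N, (l[(c : ℕ)]?).elim 0 g = (∑ e ∈ l.toFinset, g e) / N := by
  rw [Fintype.expect_eq_sum_div_card, Fintype.card_fin,
    Fin.sum_univ_eq_sum_range (fun i => (l[i]?).elim 0 g) N, sum_range_getElem? l g hN,
    List.sum_toFinset g hl]

open Finset in
theorem expect_dvd {a B : ℕ} (h : a ≤ B) :
    𝔼 c : Fin (2 ^ B), ind (2 ^ a ∣ (c : ℕ)) = (2 ^ a)⁻¹ := by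
  rw [Fintype.expect_eq_sum_div_card, Fintype.card_fin,
    Fin.sum_univ_eq_sum_range (fun i => ind (2 ^ a ∣ i)) (2 ^ B)]
  have h1 : ∑ i ∈ range (2 ^ B), ind (2 ^ a ∣ i) = 2 ^ (B - a) := by
    have hind : ∀ i, ind (2 ^ a ∣ i) = if 2 ^ a ∣ i then 1 else 0 := fun i => by
      by_cases h : 2 ^ a ∣ i <;> simp [ind, h]
    simp only [hind, sum_boole]
    have : {i ∈ range (2 ^ B) | 2 ^ a ∣ i} = (range (2 ^ (B - a))).image (2 ^ a * ·) := by
      ext i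
      simp only [mem_filter, mem_range, mem_image]
      constructor
      · rintro ⟨h1, j, rfl⟩
        refine ⟨j, ?_, rfl⟩
        rw [← Nat.add_sub_cancel' h, pow_add] at h1
        exact lt_of_mul_lt_mul_left h1 (Nat.zero_le _)
      · rintro ⟨j, hj, rfl⟩
        refine ⟨?_, dvd_mul_right _ _⟩
        rw [← Nat.add_sub_cancel' h, pow_add]
        gcongr
    rw [this, card_image_of_injective _ fun x y hxy => Nat.eq_of_mul_eq_mul_left (by positivity) hxy]
    simp
  rw [h1]
  push_cast
  rw [div_eq_iff (by positivity), ← Nat.add_sub_cancel' h, pow_add]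
  field_simp
  simp

section Round

variable (p : Params) (I : SetCoverInstance) (ρ : ℕ → ℕ → ℕ → ℕ)

/-- The test of `S` in round `n` with random numbers `ξ`. -/
def test (n S : ℕ) (ξ : SetSample p) : Bool :=
  hi p I (splice (I := I) ρ n fun _ => ξ) n S

/-- The probability that the test of `S` in round `n` succeeds. -/
noncomputable def hp (n S : ℕ) : ℝ := 𝔼 ξ : SetSample p, ind (test p I ρ n S ξ = true)

variable {n S : ℕ}

/-- The test of `S` depends on the earlier rounds and on the own numbers of `S` only. With the
earlier rounds fixed, the tests of different sets in a round are therefore independent. -/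
theorem hi_splice (hS : S < I.numSets) (r : RoundSample p I) :
    hi p I (splice ρ n r) n S = test p I ρ n S (r ⟨S, hS⟩) := by
  have hA : Agree p I n (splice ρ n r) (splice ρ n fun _ => r ⟨S, hS⟩) := fun m hm S hS i hi => by
    rw [agree_splice p I ρ n r m hm S hS i hi, agree_splice p I ρ n _ m hm S hS i hi]
  rw [test, hi_eq, hi_eq]
  refine scanSlots_congr p I _ _ hA (fun m hm S' hS' => hi_congr p I _ hA hm hS') _ _ _
    fun i _ _ => ?_
  rw [splice_self, splice_self]
  simp [RoundSample.val, hS]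

theorem test_congr {ξ ξ' : SetSample p} (h : ∀ i ≠ 0, ξ i = ξ' i) :
    test p I ρ n S ξ = test p I ρ n S ξ' := by
  have hA : Agree p I n (splice (I := I) ρ n fun _ => ξ) (splice (I := I) ρ n fun _ => ξ') :=
    fun m hm S hS i hi => by
      rw [agree_splice p I ρ n _ m hm S hS i hi, agree_splice p I ρ n _ m hm S hS i hi]
  rw [test, test, hi_eq, hi_eq]
  refine scanSlots_congr p I _ _ hA (fun m hm S' hS' => hi_congr p I _ hA hm hS') _ _ _
    fun i hi _ => ?_
  rw [splice_self, splice_self]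
  simp only [RoundSample.val, SetSample.val]
  split_ifs with h1 h2
  · rw [h ⟨i, h2⟩ (by simp [Fin.ext_iff]; omega)]
  · rfl
  · rfl

theorem hp_nonneg : 0 ≤ hp p I ρ n S := expect_nonneg' fun _ => ind_nonneg _

theorem hp_le_one : hp p I ρ n S ≤ 1 := by
  refine (expect_mono fun _ => ind_le_one _).trans ?_
  simp

/-- Coin and test are independent. -/
theorem expect_dvd_mul_test {a : ℕ} (ha : a ≤ p.B) :
    𝔼 ξ : SetSample p, ind (2 ^ a ∣ ξ.val 0) * ind (test p I ρ n S ξ = true) =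
      (2 ^ a)⁻¹ * hp p I ρ n S := by
  rw [expect_update 0, hp, Finset.mul_expect]
  refine Finset.expect_congr rfl fun ξ _ => ?_
  have h1 : ∀ c, test p I ρ n S (Function.update ξ 0 c) = test p I ρ n S ξ := fun c =>
    test_congr p I ρ fun i hi => Function.update_of_ne hi _ _
  have h2 : ∀ c, SetSample.val (Function.update ξ 0 c) 0 = c := fun c => by
    simp [SetSample.val]
  simp only [h1, h2]
  rw [← Finset.expect_mul, expect_dvd ha]

theorem expect_dvd_val {a : ℕ} (ha : a ≤ p.B) :
    𝔼 ξ : SetSample p, ind (2 ^ a ∣ ξ.val 0) = (2 ^ a)⁻¹ := by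
  rw [← expect_dvd ha, ← expect_eval (0 : Fin (p.slots p.rounds + 1))
    (fun c : Fin (2 ^ p.B) => ind (2 ^ a ∣ (c : ℕ)))]
  simp [SetSample.val]

/-- The number of active elements of `S` before round `n`. -/
noncomputable def numAct (S n : ℕ) : ℝ :=
  ∑ e ∈ (I.setList S).toFinset, ind (Act p I ρ e n)

/-- The position `c` of `S` holds an active element. -/
def Hit (n S c : ℕ) : Prop := ∃ e, (I.setList S)[c]? = some e ∧ Act p I ρ e n

theorem ind_hit (c : ℕ) :
    ind (Hit p I ρ n S c) = ((I.setList S)[c]?).elim 0 fun e => ind (Act p I ρ e n) := by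
  unfold Hit
  cases (I.setList S)[c]? with
  | none => simp [ind_of_not]
  | some e => simp

theorem expect_hit (hL : (I.setList S).length ≤ 2 ^ p.B) :
    𝔼 c : Fin (2 ^ p.B), ind (Hit p I ρ n S c) = numAct p I ρ S n / 2 ^ p.B := by
  simp only [ind_hit]
  rw [expect_getElem? _ (setList_nodup I S) _ hL, numAct]
  simp

theorem expect_hit_val (hL : (I.setList S).length ≤ 2 ^ p.B) {i : ℕ} (hi : i ≤ p.slots p.rounds) :
    𝔼 ξ : SetSample p, ind (Hit p I ρ n S (ξ.val i)) = numAct p I ρ S n / 2 ^ p.B := by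
  rw [← expect_hit p I ρ hL, ← expect_eval (⟨i, by omega⟩ : Fin (p.slots p.rounds + 1))
    (fun c : Fin (2 ^ p.B) => ind (Hit p I ρ n S c))]
  simp [SetSample.val, Nat.lt_succ_of_le hi]

theorem numAct_nonneg : 0 ≤ numAct p I ρ S n := Finset.sum_nonneg fun _ _ => ind_nonneg _

theorem stat_splice (ξ : RoundSample p I) (e : ℕ) :
    stat p I (splice ρ n ξ) e n = stat p I ρ e n :=
  stat_congr p I _ (agree_splice p I ρ n ξ) e

/-- A union bound over the slots: success requires that some slot holds an active element. -/
theorem hp_le (hS : S < I.numSets) (hn : n < p.rounds) (hL : (I.setList S).length ≤ 2 ^ p.B) :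
    hp p I ρ n S ≤ p.slots n * (numAct p I ρ S n / 2 ^ p.B) := by
  have hsl := slots_mono p hn.le
  calc hp p I ρ n S ≤ 𝔼 ξ : SetSample p,
        ∑ j ∈ Finset.range (p.slots n), ind (Hit p I ρ n S (ξ.val (j + 1))) := by
        refine expect_mono fun ξ => ?_
        by_cases h : test p I ρ n S ξ = true
        · rw [ind_of h]
          unfold test at h
          rw [hi_eq] at h
          obtain ⟨j, -, hj, e, he, hact⟩ := exists_of_scanSlots p I _ _ h
          have hit : Hit p I ρ n S (ξ.val (j + 1)) := by
            refine ⟨e, ?_, ?_⟩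
            · rw [splice_self] at he
              simpa [RoundSample.val, hS] using he
            · unfold Act
              rw [← stat_splice p I ρ (fun _ => ξ)]
              exact hact
          rw [← ind_of hit]
          exact Finset.single_le_sum (f := fun j => ind (Hit p I ρ n S (ξ.val (j + 1))))
            (fun _ _ => ind_nonneg _) (Finset.mem_range.2 (by omega))
        · rw [ind_of_not h]
          exact Finset.sum_nonneg fun _ _ => ind_nonneg _
    _ = _ := by
        rw [Finset.expect_sum_comm, Finset.sum_congr rfl fun j hj => expect_hit_val p I ρ hL
          (by have := Finset.mem_range.1 hj; omega)]
        simp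

/-- The total work for all positions of `S` before round `n`. -/
noncomputable def totalWeight (S n : ℕ) : ℝ :=
  ∑ m ∈ Finset.range n, 4 ^ m * numAct p I ρ S m

theorem sum_elemWeight :
    ∑ e ∈ (I.setList S).toFinset, (elemWeight p I ρ (hi p I ρ) e n : ℝ) =
      totalWeight p I ρ S n := by
  simp only [elemWeight, totalWeight, numAct, Nat.cast_sum, Finset.mul_sum]
  rw [Finset.sum_comm]
  refine Finset.sum_congr rfl fun m _ => Finset.sum_congr rfl fun e _ => ?_
  by_cases h : Act p I ρ e m
  · rw [ind_of h]; simp [h]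
  · rw [ind_of_not h]; simp [h]

theorem expect_posWeight (hL : (I.setList S).length ≤ 2 ^ p.B) {i : ℕ}
    (hi' : i ≤ p.slots p.rounds) :
    𝔼 ξ : SetSample p, (posWeight p I ρ (hi p I ρ) n S (ξ.val i) : ℝ) =
      totalWeight p I ρ S n / 2 ^ p.B := by
  have h1 := expect_getElem? _ (setList_nodup I S)
    (fun e => (elemWeight p I ρ (hi p I ρ) e n : ℝ)) hL
  rw [sum_elemWeight] at h1
  push_cast at h1
  rw [← h1, ← expect_eval (⟨i, by omega⟩ : Fin (p.slots p.rounds + 1)) (fun c : Fin (2 ^ p.B) =>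
    ((I.setList S)[(c : ℕ)]?).elim 0 fun e => (elemWeight p I ρ (hi p I ρ) e n : ℝ))]
  refine Finset.expect_congr rfl fun ξ _ => ?_
  simp only [SetSample.val, Nat.lt_succ_of_le hi', dif_pos, posWeight]
  cases (I.setList S)[((ξ ⟨i, by omega⟩ : Fin (2 ^ p.B)) : ℕ)]? <;> simp

theorem posWeight_splice (r : RoundSample p I) (c : ℕ) :
    posWeight p I (splice ρ n r) (hi p I (splice ρ n r)) n S c =
      posWeight p I ρ (hi p I ρ) n S c := by
  unfold posWeight
  have := fun e => elemWeight_congr p I _ (hi p I (splice ρ n r)) (agree_splice p I ρ n r)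
    (fun m hm S' hS' => hi_congr p I _ (agree_splice p I ρ n r) hm hS') e le_rfl
  simp only [this]

/-- A set with many active elements fails the test with small probability. -/
theorem one_sub_hp_le (hS : S < I.numSets) (hn : n < p.rounds)
    (hL : (I.setList S).length ≤ 2 ^ p.B) {m : ℕ} (hm : m ≤ p.slots n) :
    1 - hp p I ρ n S ≤ (1 - numAct p I ρ S n / 2 ^ p.B) ^ m +
      m * (totalWeight p I ρ S n / 2 ^ p.B) / budget n := by
  have hsl := slots_mono p hn.le
  have hb : (0 : ℝ) < budget n := by unfold budget; positivity
  have h1 : 1 - hp p I ρ n S = 𝔼 ξ : SetSample p, ind (test p I ρ n S ξ = false) := by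
    have : ∀ ξ : SetSample p, ind (test p I ρ n S ξ = false) =
        1 - ind (test p I ρ n S ξ = true) := fun ξ => by
      rw [← ind_not, Bool.not_eq_true]
    simp only [this]
    rw [Finset.expect_sub_distrib, hp]
    simp
  -- A failed test either missed in all of the first `m` slots or exceeded its budget on them. The
  -- product form suits independence; the second event is replaced by Markov's bound.
  have hpt : ∀ ξ : SetSample p, ind (test p I ρ n S ξ = false) ≤
      ∏ j : Fin m, ind (¬ Hit p I ρ n S (ξ.val (j + 1))) +
      (∑ j ∈ Finset.range m, (posWeight p I ρ (hi p I ρ) n S (ξ.val (j + 1)) : ℝ)) / budget n := by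
    intro ξ
    have hp1 : 0 ≤ ∏ j : Fin m, ind (¬ Hit p I ρ n S (ξ.val (j + 1))) :=
      Finset.prod_nonneg fun _ _ => ind_nonneg _
    have hp2 : 0 ≤ ∑ j ∈ Finset.range m,
      (posWeight p I ρ (hi p I ρ) n S (ξ.val (j + 1)) : ℝ) := by positivity
    by_cases h : test p I ρ n S ξ = false
    · rw [ind_of h]
      unfold test at h
      rw [hi_eq] at h
      have hv : ∀ i, splice (I := I) ρ n (fun _ => ξ) n S i = ξ.val i := fun i => by
        rw [splice_self]; simp [RoundSample.val, hS]
      rcases scanSlots_false p I _ _ h m hm with h2 | h2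
      · have : ∏ j : Fin m, ind (¬ Hit p I ρ n S (ξ.val (j + 1))) = 1 := by
          refine Finset.prod_eq_one fun j _ => ind_of ?_
          rintro ⟨e, he, hact⟩
          have := h2 j (by omega) (by omega) e (by rw [hv]; exact he)
          unfold Act at hact
          rw [← stat_splice p I ρ (fun _ => ξ)] at hact
          exact absurd (hact.symm.trans this) (by simp)
        rw [this]
        have : 0 ≤ (∑ j ∈ Finset.range m,
          (posWeight p I ρ (hi p I ρ) n S (ξ.val (j + 1)) : ℝ)) / budget n := by positivity
        linarith
      · simp only [hv, posWeight_splice, zero_add] at h2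
        have h3 : (budget n : ℝ) < ∑ j ∈ Finset.range m,
            (posWeight p I ρ (hi p I ρ) n S (ξ.val (j + 1)) : ℝ) := by exact_mod_cast h2
        have := ind_lt_le_div hb hp2
        rw [ind_of h3] at this
        linarith
    · rw [ind_of_not h]; positivity
  rw [h1]
  refine (expect_mono hpt).trans ?_
  rw [Finset.expect_add_distrib, ← Finset.expect_div, Finset.expect_sum_comm]
  refine add_le_add (le_of_eq ?_) (le_of_eq ?_)
  · have := expect_prod_subset (α := Fin (2 ^ p.B))
      ((Finset.univ : Finset (Fin m)).map
        ⟨fun j : Fin m => (⟨(j : ℕ) + 1, by omega⟩ : Fin (p.slots p.rounds + 1)), fun a b h => by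
          simpa [Fin.ext_iff] using h⟩)
      (fun _ c => ind (¬ Hit p I ρ n S c))
    simp only [Finset.prod_map] at this
    have h3 : ∀ (ξ : SetSample p) (j : Fin m),
        ξ.val (j + 1) = (ξ ⟨j + 1, by omega⟩ : ℕ) := fun ξ j => by
      rw [SetSample.val, dif_pos]
    simp only [h3]
    refine this.trans ?_
    have h4 : 𝔼 c : Fin (2 ^ p.B), ind (¬ Hit p I ρ n S c) = 1 - numAct p I ρ S n / 2 ^ p.B := by
      simp only [ind_not]
      rw [Finset.expect_sub_distrib, expect_hit p I ρ hL]
      simp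
    simp [h4]
  · rw [Finset.sum_congr rfl fun j hj => expect_posWeight p I ρ hL
      (by have := Finset.mem_range.1 hj; omega)]
    simp

end Round
end SparseGreedy

namespace SparseGreedy

/-! ### The expected work per element -/

/-- Induction on `(1 - x) * (1 + x + s) ≤ 1 + s` for `s ≥ 0`. This rational bound takes the place of
`exp (-∑ x)` and suffices everywhere below. -/
theorem prod_one_sub_le_inv {ι : Type*} (s : Finset ι) (x : ι → ℝ) (h0 : ∀ i ∈ s, 0 ≤ x i)
    (h1 : ∀ i ∈ s, x i ≤ 1) : ∏ i ∈ s, (1 - x i) ≤ (1 + ∑ i ∈ s, x i)⁻¹ := by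
  classical
  induction s using Finset.induction_on with
  | empty => simp
  | insert a s ha ih =>
    have hi := ih (fun i hi => h0 i (by simp [hi])) (fun i hi => h1 i (by simp [hi]))
    have hs : 0 ≤ ∑ i ∈ s, x i := Finset.sum_nonneg fun i hi => h0 i (by simp [hi])
    have ha0 := h0 a (by simp)
    have ha1 := h1 a (by simp)
    rw [Finset.prod_insert ha, Finset.sum_insert ha]
    calc (1 - x a) * ∏ i ∈ s, (1 - x i) ≤ (1 - x a) * (1 + ∑ i ∈ s, x i)⁻¹ := by
          gcongr
      _ ≤ _ := by
          rw [← div_eq_mul_inv, div_le_iff₀ (by positivity), ← div_eq_inv_mul,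
            le_div_iff₀ (by positivity)]
          nlinarith [mul_nonneg ha0 hs, mul_nonneg ha0 ha0, mul_nonneg (mul_nonneg ha0 ha0) hs]

section Potential

variable (p : Params) (I : SetCoverInstance) (ρ : ℕ → ℕ → ℕ → ℕ)

/-- The sets that contain `e`. -/
def nb (e : ℕ) : Finset (Fin I.numSets) := Finset.univ.filter fun S => (S : ℕ) ∈ I.elemList e

theorem mem_nb {e : ℕ} {S : Fin I.numSets} : S ∈ nb I e ↔ (S : ℕ) ∈ I.elemList e := by
  simp [nb]

theorem sum_nb (e : ℕ) {M : Type*} [AddCommMonoid M] (g : ℕ → M) :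
    ∑ S ∈ nb I e, g S = ((I.elemList e).map g).sum := by
  rw [← List.sum_toFinset g (elemList_nodup I e)]
  refine Finset.sum_bij (fun S _ => (S : ℕ)) ?_ ?_ ?_ ?_
  · intro S hS
    simpa using (mem_nb I).1 hS
  · intro S _ S' _ h
    exact Fin.ext h
  · intro S hS
    have hS := List.mem_toFinset.1 hS
    exact ⟨⟨S, elemList_lt I hS⟩, (mem_nb I).2 hS, rfl⟩
  · intros; rfl

theorem card_nb (e : ℕ) : (nb I e).card = (I.elemList e).length := by
  have := sum_nb I e (fun _ => 1)
  simpa using this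

/-- The probability with which `S` volunteers in round `n`. -/
noncomputable def qq (S n : ℕ) : ℝ := (2 ^ ex p I ρ S n)⁻¹

/-- The expected number of volunteers among the sets that contain `e`. -/
noncomputable def QQ (e n : ℕ) : ℝ := ∑ S ∈ nb I e, qq p I ρ S n

theorem qq_pos (S n : ℕ) : 0 < qq p I ρ S n := by unfold qq; positivity

theorem qq_le_one (S n : ℕ) : qq p I ρ S n ≤ 1 := by
  unfold qq
  exact inv_le_one_of_one_le₀ (one_le_pow₀ (by norm_num))

theorem QQ_nonneg (e n : ℕ) : 0 ≤ QQ p I ρ e n :=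
  Finset.sum_nonneg fun _ _ => (qq_pos p I ρ _ _).le

variable {n : ℕ}

theorem ex_splice (r : RoundSample p I) {S : ℕ} (hS : S < I.numSets) {m : ℕ} (hm : m ≤ n) :
    ex p I (splice ρ n r) S m = ex p I ρ S m :=
  ex_congr p I _ ((agree_splice p I ρ n r).mono p I hm) hS

theorem act_splice (r : RoundSample p I) (e : ℕ) {m : ℕ} (hm : m ≤ n) :
    Act p I (splice ρ n r) e m ↔ Act p I ρ e m := by
  unfold Act
  rw [stat_congr p I _ ((agree_splice p I ρ n r).mono p I hm)]

theorem unc_splice (r : RoundSample p I) (e : ℕ) {m : ℕ} (hm : m ≤ n) :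
    Unc p I (splice ρ n r) e m ↔ Unc p I ρ e m := by
  unfold Unc
  rw [stat_congr p I _ ((agree_splice p I ρ n r).mono p I hm)]

theorem joined_splice (r : RoundSample p I) (S : Fin I.numSets) :
    Joined p I (splice ρ n r) n S ↔
      2 ^ ex p I ρ S n ∣ (r S).val 0 ∧ test p I ρ n S (r S) = true := by
  unfold Joined
  rw [ex_splice p I ρ r S.2 le_rfl, hi_splice p I ρ S.2, splice_self]
  simp [RoundSample.val]

theorem expect_joined (S : Fin I.numSets) :
    𝔼 r : RoundSample p I, ind (Joined p I (splice ρ n r) n S) =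
      qq p I ρ S n * hp p I ρ n S := by
  simp only [joined_splice, ind_and]
  rw [expect_eval S (fun ξ : SetSample p =>
    ind (2 ^ ex p I ρ S n ∣ ξ.val 0) * ind (test p I ρ n S ξ = true)),
    expect_dvd_mul_test p I ρ (expo_le_B p _ _ _)]
  rfl

theorem ex_succ_splice (hn : (n + 1) % p.T ≠ 0) (r : RoundSample p I) (S : Fin I.numSets) :
    ex p I (splice ρ n r) S (n + 1) =
      if test p I ρ n S (r S) then ex p I ρ S n - 1 else ex p I ρ S n + 2 := by
  unfold ex
  rw [expo_succ p _ hn, hi_splice p I ρ S.2]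
  have := ex_splice p I ρ r S.2 (le_refl n)
  unfold ex at this
  rw [this]

/-- The factors are `1 / 4` after failure and at most `2` after success; at exponent `0` the
probability stays `1`. The affine form in the indicator makes the expectation immediate. -/
theorem qq_succ_splice_le (hn : (n + 1) % p.T ≠ 0) (r : RoundSample p I) (S : Fin I.numSets) :
    qq p I (splice ρ n r) S (n + 1) ≤ qq p I ρ S n *
      (1 / 4 + 7 / 4 * ind (test p I ρ n S (r S) = true)) := by
  unfold qq
  rw [ex_succ_splice p I ρ hn]
  by_cases h : test p I ρ n S (r S) = true
  · rw [if_pos h, ind_of h]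
    rcases Nat.eq_zero_or_pos (ex p I ρ S n) with h0 | h0
    · rw [h0]; norm_num
    · obtain ⟨a, ha⟩ : ∃ a, ex p I ρ S n = a + 1 := ⟨ex p I ρ S n - 1, by omega⟩
      rw [ha, Nat.add_sub_cancel, pow_succ, mul_inv]
      linarith [show (0 : ℝ) < (2 ^ a)⁻¹ by positivity]
  · rw [if_neg h, ind_of_not h, pow_add, mul_inv]
    norm_num

theorem qq_succ_splice_le_two (hn : (n + 1) % p.T ≠ 0) (r : RoundSample p I)
    (S : Fin I.numSets) : qq p I (splice ρ n r) S (n + 1) ≤ 2 * qq p I ρ S n := by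
  refine (qq_succ_splice_le p I ρ hn r S).trans ?_
  have h1 := ind_le_one (test p I ρ n S (r S) = true)
  have h2 := qq_pos p I ρ S n
  nlinarith

theorem expect_qq_succ_le (hn : (n + 1) % p.T ≠ 0) {S : Fin I.numSets}
    (hS : hp p I ρ n S ≤ 1 / 7) :
    𝔼 r : RoundSample p I, qq p I (splice ρ n r) S (n + 1) ≤ qq p I ρ S n / 2 := by
  refine (expect_mono fun r => qq_succ_splice_le p I ρ hn r S).trans ?_
  rw [expect_eval S (fun ξ : SetSample p =>
    qq p I ρ S n * (1 / 4 + 7 / 4 * ind (test p I ρ n S ξ = true))), ← Finset.mul_expect,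
    Finset.expect_add_distrib, ← Finset.mul_expect]
  change qq p I ρ S n * (_ + 7 / 4 * hp p I ρ n S) ≤ _
  have := qq_pos p I ρ S n
  rw [Fintype.expect_const]
  nlinarith

/-- The potential of an active element decreases in each round by the number of volunteers. -/
theorem expect_potential_le (hn : (n + 1) % p.T ≠ 0) (e : ℕ) :
    𝔼 r : RoundSample p I, ind (Act p I (splice ρ n r) e (n + 1)) *
      (21 + 2 * QQ p I (splice ρ n r) e (n + 1)) ≤ ind (Act p I ρ e n) * (21 + QQ p I ρ e n) := by
  classical
  by_cases hA : Act p I ρ e n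
  swap
  · rw [ind_of_not hA, zero_mul]
    refine le_of_eq (Finset.expect_eq_zero fun r _ => ?_)
    rw [ind_of_not, zero_mul]
    exact fun h => hA ((act_splice p I ρ r e le_rfl).1 (h.of_succ hn).1)
  -- At success probability `1 / 7` the expected factor `1 / 4 + 7 / 4 * (1 / 7)` equals `1 / 2`.
  -- The sets in `R` thus halve in expectation, which offsets the coefficient `2` of the potential.
  -- The sets in `G` may double, but each joins with probability at least `qq / 7` and then the
  -- element is no longer active.
  set G : Finset (Fin I.numSets) := (nb I e).filter fun S => 1 / 7 ≤ hp p I ρ n S with hG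
  set R : Finset (Fin I.numSets) := (nb I e).filter fun S => ¬ 1 / 7 ≤ hp p I ρ n S with hR
  set g := ∑ S ∈ G, qq p I ρ S n with hg
  have hg0 : 0 ≤ g := Finset.sum_nonneg fun _ _ => (qq_pos p I ρ _ _).le
  have hpt : ∀ r : RoundSample p I, ind (Act p I (splice ρ n r) e (n + 1)) *
      (21 + 2 * QQ p I (splice ρ n r) e (n + 1)) ≤
      (∏ S ∈ G, ind (¬ (2 ^ ex p I ρ S n ∣ (r S).val 0 ∧ test p I ρ n S (r S) = true))) *
        (21 + 4 * g) + 2 * ∑ S ∈ R, qq p I (splice ρ n r) S (n + 1) := by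
    intro r
    have hR0 : 0 ≤ ∑ S ∈ R, qq p I (splice ρ n r) S (n + 1) :=
      Finset.sum_nonneg fun _ _ => (qq_pos p I _ _ _).le
    have hP0 : 0 ≤ ∏ S ∈ G, ind (¬ (2 ^ ex p I ρ S n ∣ (r S).val 0 ∧
      test p I ρ n S (r S) = true)) := Finset.prod_nonneg fun _ _ => ind_nonneg _
    by_cases hA' : Act p I (splice ρ n r) e (n + 1)
    · have h1 : ∏ S ∈ G, ind (¬ (2 ^ ex p I ρ S n ∣ (r S).val 0 ∧
          test p I ρ n S (r S) = true)) = 1 := by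
        refine Finset.prod_eq_one fun S hS => ind_of ?_
        rw [← joined_splice]
        exact (hA'.of_succ hn).2 S ((mem_nb I).1 (Finset.mem_filter.1 hS).1)
      have h2 : QQ p I (splice ρ n r) e (n + 1) =
          ∑ S ∈ G, qq p I (splice ρ n r) S (n + 1) + ∑ S ∈ R, qq p I (splice ρ n r) S (n + 1) :=
        (Finset.sum_filter_add_sum_filter_not _ _ _).symm
      have h3 : ∑ S ∈ G, qq p I (splice ρ n r) S (n + 1) ≤ 2 * g := by
        rw [hg, Finset.mul_sum]
        exact Finset.sum_le_sum fun S _ => qq_succ_splice_le_two p I ρ hn r S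
      rw [ind_of hA', h1, h2]
      linarith
    · rw [ind_of_not hA', zero_mul]
      positivity
  refine (expect_mono hpt).trans ?_
  rw [Finset.expect_add_distrib, ← Finset.expect_mul, ← Finset.mul_expect, Finset.expect_sum_comm,
    ind_of hA, one_mul]
  have h1 : 𝔼 r : RoundSample p I,
      ∏ S ∈ G, ind (¬ (2 ^ ex p I ρ S n ∣ (r S).val 0 ∧ test p I ρ n S (r S) = true)) =
      ∏ S ∈ G, (1 - qq p I ρ S n * hp p I ρ n S) := by
    rw [expect_prod_subset G (fun S (ξ : SetSample p) =>
      ind (¬ (2 ^ ex p I ρ S n ∣ ξ.val 0 ∧ test p I ρ n S ξ = true)))]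
    refine Finset.prod_congr rfl fun S _ => ?_
    simp only [ind_not, ind_and]
    rw [Finset.expect_sub_distrib, expect_dvd_mul_test p I ρ (expo_le_B p _ _ _)]
    simp [qq]
  have h2 : ∏ S ∈ G, (1 - qq p I ρ S n * hp p I ρ n S) ≤ (1 + g / 7)⁻¹ := by
    refine (prod_one_sub_le_inv G _ (fun S _ => mul_nonneg (qq_pos p I ρ _ _).le (hp_nonneg p I ρ))
      fun S _ => mul_le_one₀ (qq_le_one p I ρ _ _) (hp_nonneg p I ρ) (hp_le_one p I ρ)).trans ?_
    gcongr
    rw [hg, Finset.sum_div]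
    refine Finset.sum_le_sum fun S hS => ?_
    have := (Finset.mem_filter.1 hS).2
    have := qq_pos p I ρ S n
    rw [div_eq_mul_one_div]
    gcongr
  have h3 : ∑ S ∈ R, 𝔼 r : RoundSample p I, qq p I (splice ρ n r) S (n + 1) ≤
      ∑ S ∈ R, qq p I ρ S n / 2 := Finset.sum_le_sum fun S hS =>
    expect_qq_succ_le p I ρ hn (not_le.1 (Finset.mem_filter.1 hS).2).le
  have h4 : QQ p I ρ e n = g + ∑ S ∈ R, qq p I ρ S n :=
    (Finset.sum_filter_add_sum_filter_not _ _ _).symm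
  -- The constant `21` is the least that works: `(21 + g) * (1 + g / 7) = 21 + 4 * g + g ^ 2 / 7`.
  have h5 : (1 + g / 7)⁻¹ * (21 + 4 * g) ≤ 21 + g := by
    rw [← div_eq_inv_mul, div_le_iff₀ (by positivity)]
    nlinarith
  rw [h1, h4]
  rw [← Finset.sum_div] at h3
  have h6 : (∏ S ∈ G, (1 - qq p I ρ S n * hp p I ρ n S)) * (21 + 4 * g) ≤
      (1 + g / 7)⁻¹ * (21 + 4 * g) := by gcongr
  linarith

/-- Markov's inequality for the work in the scan. The coin of round `n` is independent of the
exponents, so level `n - j` of a set is reached with probability at most `2 ^ j * qq`. At `4 ^ (n -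
j)` units this is `4 ^ n * (1 / 2) ^ j * qq`: the weights `4 ^ m` beat the loss `2 ^ j` from
pruning. -/
theorem expect_stalls_le {k t : ℕ} (ht : t < p.T) (hn : n = k * p.T + t) (e : ℕ) :
    𝔼 r : RoundSample p I, ind (Stalls p I (splice ρ n r) e n) ≤
      (∑ j ∈ Finset.range (t + 1), (1 / 2) ^ j *
        (ind (Act p I ρ e (n - j)) * QQ p I ρ e (n - j))) / 2 ^ 16 := by
  have hmod : n % p.T = t := by
    rw [hn, add_comm, Nat.add_mul_mod_self_right, Nat.mod_eq_of_lt ht]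
  have hb : (0 : ℝ) < budget n := by unfold budget; positivity
  by_cases hA : Act p I ρ e n
  swap
  · rw [Finset.expect_eq_zero]
    · exact div_nonneg (Finset.sum_nonneg fun j _ => mul_nonneg (by positivity)
        (mul_nonneg (ind_nonneg _) (QQ_nonneg p I ρ _ _))) (by positivity)
    · intro r _
      exact ind_of_not fun h => hA ((act_splice p I ρ r e le_rfl).1 h.1)
  have hpt : ∀ r : RoundSample p I, ind (Stalls p I (splice ρ n r) e n) ≤
      (∑ S ∈ nb I e, ∑ j ∈ Finset.range (t + 1),
        4 ^ (n - j) * ind (2 ^ (ex p I ρ S (n - j) - j) ∣ (r S).val 0)) / budget n := by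
    intro r
    refine (ind_mono fun h => ?_).trans (ind_lt_le_div hb (Finset.sum_nonneg fun S _ =>
      Finset.sum_nonneg fun j _ => mul_nonneg (by positivity) (ind_nonneg _)))
    have h1 := scanSets_stalled p _ _ h.2
    rw [zero_add, ← sum_nb I e (fun S => (evalSet p (splice ρ n r) _ n S).1)] at h1
    have h2 : (budget n : ℝ) <
        ∑ S ∈ nb I e, ((evalSet p (splice ρ n r) (hi p I (splice ρ n r)) n S).1 : ℝ) := by
      exact_mod_cast h1
    refine h2.trans_le (Finset.sum_le_sum fun S _ => ?_)
    have h3 := evalSet_fst_le_sum p I (splice ρ n r) n S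
    rw [hmod] at h3
    refine (Nat.cast_le.2 h3).trans (le_of_eq ?_)
    push_cast
    refine Finset.sum_congr rfl fun j _ => ?_
    rw [ex_splice p I ρ r S.2 (Nat.sub_le _ _), splice_self]
    have : RoundSample.val r S 0 = (r S).val 0 := by simp [RoundSample.val]
    rw [this]
    by_cases hd : 2 ^ (ex p I ρ S (n - j) - j) ∣ (r S).val 0
    · rw [ind_of hd, if_pos hd, mul_one]
    · rw [ind_of_not hd, if_neg hd, mul_zero]
  refine (expect_mono hpt).trans ?_
  rw [← Finset.expect_div, Finset.expect_sum_comm, Finset.sum_congr rfl fun S _ =>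
    Finset.expect_sum_comm _ _ _, Finset.sum_comm, div_le_iff₀ hb, div_mul_eq_mul_div,
    le_div_iff₀ (by positivity), Finset.sum_mul, Finset.sum_mul]
  refine Finset.sum_le_sum fun j hj => ?_
  have hj : j ≤ t := by have := Finset.mem_range.1 hj; omega
  have hA' : Act p I ρ e (n - j) := by
    rw [hn, Nat.add_sub_assoc hj]
    exact Act.mono_phase (hn ▸ hA) ht (Nat.sub_le _ _)
  rw [ind_of hA', one_mul, QQ, Finset.mul_sum, Finset.sum_mul, Finset.sum_mul]
  refine Finset.sum_le_sum fun S _ => ?_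
  rw [← Finset.mul_expect, expect_eval S (fun ξ : SetSample p =>
    ind (2 ^ (ex p I ρ S (n - j) - j) ∣ ξ.val 0)), expect_dvd_val p
    ((Nat.sub_le _ _).trans (expo_le_B p _ _ _))]
  have h1 : ((2 : ℝ) ^ (ex p I ρ S (n - j) - j))⁻¹ ≤ 2 ^ j * qq p I ρ S (n - j) := by
    unfold qq
    rw [← div_eq_mul_inv, le_div_iff₀ (by positivity), ← div_eq_inv_mul,
      div_le_iff₀ (by positivity), ← pow_add]
    exact pow_le_pow_right₀ (by norm_num) (by omega)
  have h2 : (4 : ℝ) ^ n = 4 ^ (n - j) * 2 ^ j * 2 ^ j := by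
    rw [mul_assoc, ← mul_pow]
    norm_num
    rw [← pow_add, Nat.sub_add_cancel (by omega)]
  unfold budget
  push_cast
  rw [h2]
  have h3 : ((1 : ℝ) / 2) ^ j * 2 ^ j = 1 := by rw [← mul_pow]; norm_num
  calc (4 : ℝ) ^ (n - j) * (2 ^ (ex p I ρ S (n - j) - j))⁻¹ * 2 ^ 16
      ≤ 4 ^ (n - j) * (2 ^ j * qq p I ρ S (n - j)) * 2 ^ 16 := by gcongr
    _ = ((1 / 2) ^ j * 2 ^ j) * (4 ^ (n - j) * (2 ^ j * qq p I ρ S (n - j)) * 2 ^ 16) := by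
        rw [h3, one_mul]
    _ = _ := by ring

end Potential
end SparseGreedy

namespace SparseGreedy

/-! ### One phase -/

section Phase

variable (p : Params) (I : SetCoverInstance)

theorem phase_lt_rounds {k t : ℕ} (hk : k ≤ p.L) (ht : t < p.T) : k * p.T + t < p.rounds := by
  unfold Params.rounds
  nlinarith [Nat.mul_le_mul_right p.T hk]

theorem phase_succ_mod {k t : ℕ} (ht : t + 1 < p.T) : (k * p.T + t + 1) % p.T ≠ 0 := by
  rw [show k * p.T + t + 1 = t + 1 + k * p.T by ring, Nat.add_mul_mod_self_right,
    Nat.mod_eq_of_lt ht]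
  omega

theorem QQ_start_le (hf : ∀ e, (I.elemList e).length ≤ 2 ^ p.F) (ρ : ℕ → ℕ → ℕ → ℕ) (e k : ℕ) :
    QQ p I ρ e (k * p.T) ≤ 1 := by
  have h1 : ∀ S : Fin I.numSets, qq p I ρ S (k * p.T) = (2 ^ p.F)⁻¹ := fun S => by
    unfold qq ex
    rw [expo_of_mod_eq_zero p _ (by simp)]
  unfold QQ
  simp only [h1, Finset.sum_const, card_nb, nsmul_eq_mul]
  rw [← div_eq_mul_inv, div_le_one (by positivity)]
  exact_mod_cast hf e

/-- The expected number of volunteers that an active element sees in round `n`. -/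
noncomputable def load (e n : ℕ) : ℝ := EE p I fun ρ => ind (Act p I ρ e n) * QQ p I ρ e n

theorem load_nonneg (e n : ℕ) : 0 ≤ load p I e n :=
  EE_nonneg p I fun ρ => mul_nonneg (ind_nonneg _) (QQ_nonneg p I ρ _ _)

/-- The potential `21 + 2 * QQ` loses at least the load in each round, so the loads telescope. At
the start `QQ ≤ 1`, since at most `2 ^ F` sets volunteer with probability `2 ^ (-F)` each; this
gives `21 + 2 = 23`. -/
theorem sum_load_le (hf : ∀ e, (I.elemList e).length ≤ 2 ^ p.F) {k : ℕ} (hk : k ≤ p.L) (e : ℕ) :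
    ∑ t ∈ Finset.range p.T, load p I e (k * p.T + t) ≤
      23 * EE p I fun ρ => ind (Unc p I ρ e (k * p.T)) := by
  set φ : ℕ → ℝ := fun n => EE p I fun ρ => ind (Act p I ρ e n) * (21 + 2 * QQ p I ρ e n) with hφ
  have hstep : ∀ t, t + 1 < p.T →
      φ (k * p.T + (t + 1)) + load p I e (k * p.T + t) ≤ φ (k * p.T + t) := by
    intro t ht
    have h1 : φ (k * p.T + (t + 1)) ≤
        EE p I fun ρ => ind (Act p I ρ e (k * p.T + t)) * (21 + QQ p I ρ e (k * p.T + t)) :=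
      EE_le_of_round p I (phase_lt_rounds p hk (by omega : t < p.T))
        fun ρ => expect_potential_le p I ρ (phase_succ_mod p ht) e
    refine (add_le_add_left h1 _).trans (le_of_eq ?_)
    unfold load
    rw [← EE_add]
    simp only [hφ]
    congr 1
    funext ρ
    ring
  have hsum : ∀ t, t < p.T →
      φ (k * p.T + t) + ∑ s ∈ Finset.range t, load p I e (k * p.T + s) ≤ φ (k * p.T) := by
    intro t
    induction t with
    | zero => simp
    | succ t ih =>
      intro ht
      rw [Finset.sum_range_succ]
      have := hstep t ht
      have := ih (by omega)
      linarith
  obtain ⟨t, ht⟩ : ∃ t, p.T = t + 1 := ⟨p.T - 1, by have := p.T_pos; omega⟩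
  have h1 := hsum t (by omega)
  -- The potential step does not cross the end of the phase, where the exponents are reset. The load
  -- of the last round is paid from the potential that is left.
  have h2 : load p I e (k * p.T + t) ≤ φ (k * p.T + t) := by
    refine EE_mono p I fun ρ => mul_le_mul_of_nonneg_left ?_ (ind_nonneg _)
    have := QQ_nonneg p I ρ e (k * p.T + t)
    linarith
  have h3 : φ (k * p.T) ≤ 23 * EE p I fun ρ => ind (Unc p I ρ e (k * p.T)) := by
    rw [← EE_mul_left]
    refine EE_mono p I fun ρ => ?_
    have h4 := QQ_start_le p I hf ρ e k
    have h5 := ind_mono (fun h : Act p I ρ e (k * p.T) => h.unc)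
    have h6 := ind_nonneg (Act p I ρ e (k * p.T))
    nlinarith
  have h4 : Finset.range p.T = Finset.range (t + 1) := by rw [ht]
  rw [h4, Finset.sum_range_succ]
  linarith

/-- The probability that an element stalls in the phase is small. -/
theorem sum_stalls_le (hf : ∀ e, (I.elemList e).length ≤ 2 ^ p.F) {k : ℕ} (hk : k ≤ p.L) (e : ℕ) :
    ∑ t ∈ Finset.range p.T, EE p I (fun ρ => ind (Stalls p I ρ e (k * p.T + t))) ≤
      46 / 2 ^ 16 * EE p I fun ρ => ind (Unc p I ρ e (k * p.T)) := by
  have h1 : ∀ t ∈ Finset.range p.T, EE p I (fun ρ => ind (Stalls p I ρ e (k * p.T + t))) ≤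
      (∑ j ∈ Finset.range (t + 1), (1 / 2) ^ j * load p I e (k * p.T + (t - j))) / 2 ^ 16 := by
    intro t ht
    have ht := Finset.mem_range.1 ht
    refine (EE_le_of_round p I (phase_lt_rounds p hk ht)
      fun ρ => expect_stalls_le p I ρ ht rfl e).trans (le_of_eq ?_)
    simp only [div_eq_inv_mul]
    rw [EE_mul_left, EE_sum]
    congr 1
    refine Finset.sum_congr rfl fun j hj => ?_
    rw [EE_mul_left, Nat.add_sub_assoc (by have := Finset.mem_range.1 hj; omega)]
    rfl
  -- Convolution with a geometric series of sum `2`. The second sum is the discounted tail, the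
  -- unspent part of the bound, which carries the induction.
  have h2 : ∀ T : ℕ, ∑ t ∈ Finset.range T, ∑ j ∈ Finset.range (t + 1),
      (1 / 2 : ℝ) ^ j * load p I e (k * p.T + (t - j)) +
      ∑ j ∈ Finset.range T, (1 / 2 : ℝ) ^ (T - 1 - j) * load p I e (k * p.T + j)  ≤
      2 * ∑ t ∈ Finset.range T, load p I e (k * p.T + t) := by
    intro T
    induction T with
    | zero => simp
    | succ T ih =>
      rw [Finset.sum_range_succ _ T, Finset.sum_range_succ (fun t => load p I e (k * p.T + t)) T,
        ← Finset.sum_range_reflect (fun j => (1 / 2 : ℝ) ^ j * load p I e (k * p.T + (T - j)))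
          (T + 1)]
      have h3 : ∑ j ∈ Finset.range (T + 1), (1 / 2 : ℝ) ^ (T + 1 - 1 - j) *
            load p I e (k * p.T + (T - (T + 1 - 1 - j))) =
          ∑ j ∈ Finset.range (T + 1), (1 / 2 : ℝ) ^ (T + 1 - 1 - j) * load p I e (k * p.T + j) := by
        refine Finset.sum_congr rfl fun j hj => ?_
        have := Finset.mem_range.1 hj
        rw [show T - (T + 1 - 1 - j) = j by omega]
      have h4 : ∑ j ∈ Finset.range (T + 1), (1 / 2 : ℝ) ^ (T + 1 - 1 - j) *
            load p I e (k * p.T + j) =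
          (∑ j ∈ Finset.range T, (1 / 2 : ℝ) ^ (T - 1 - j) * load p I e (k * p.T + j)) / 2 +
            load p I e (k * p.T + T) := by
        rw [Finset.sum_range_succ, Finset.sum_div]
        congr 1
        · refine Finset.sum_congr rfl fun j hj => ?_
          have := Finset.mem_range.1 hj
          rw [show T + 1 - 1 - j = (T - 1 - j) + 1 by omega, pow_succ]
          ring
        · simp
      rw [h3, h4]
      linarith
  have h3 := sum_load_le p I hf hk e
  have h4 := h2 p.T
  have h5 : 0 ≤ ∑ j ∈ Finset.range p.T, (1 / 2 : ℝ) ^ (p.T - 1 - j) * load p I e (k * p.T + j) :=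
    Finset.sum_nonneg fun j _ => mul_nonneg (by positivity) (load_nonneg p I _ _)
  refine (Finset.sum_le_sum h1).trans ?_
  rw [← Finset.sum_div, div_le_iff₀ (by positivity)]
  linarith

/-- The number of sets that join in a round is bounded by the load of the elements. -/
theorem EE_joined_le (hΔ : ∀ S, (I.setList S).length ≤ 2 ^ p.L) {n : ℕ} (hn : n < p.rounds) :
    EE p I (fun ρ => ∑ S : Fin I.numSets, ind (Joined p I ρ n S)) ≤
      p.slots n / 2 ^ p.B * ∑ e ∈ Finset.range I.numElems, load p I e n := by
  have hB : ∀ S, (I.setList S).length ≤ 2 ^ p.B := fun S =>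
    (hΔ S).trans (Nat.pow_le_pow_right (by norm_num) (by unfold Params.B; omega))
  unfold load
  rw [← EE_sum, ← EE_mul_left]
  refine EE_le_of_round p I hn fun ρ => ?_
  rw [Finset.expect_sum_comm]
  simp only [expect_joined]
  have h1 : ∑ S : Fin I.numSets, qq p I ρ S n * hp p I ρ n S ≤
      ∑ S : Fin I.numSets, p.slots n / 2 ^ p.B * (qq p I ρ S n * numAct p I ρ S n) := by
    refine Finset.sum_le_sum fun S _ => ?_
    have := mul_le_mul_of_nonneg_left (hp_le p I ρ S.2 hn (hB S)) (qq_pos p I ρ S n).le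
    refine this.trans (le_of_eq ?_)
    ring
  refine h1.trans (le_of_eq ?_)
  rw [← Finset.mul_sum]
  congr 1
  simp only [numAct, QQ, Finset.mul_sum]
  rw [Finset.sum_comm' (s' := fun e => nb I e) (t' := Finset.range I.numElems)]
  · exact Finset.sum_congr rfl fun e _ => Finset.sum_congr rfl fun S _ => mul_comm _ _
  · intro S e
    simp only [Finset.mem_univ, true_and, List.mem_toFinset, mem_nb, Finset.mem_range,
      mem_setList_iff]
    exact ⟨fun h => ⟨h, setList_lt I ((mem_setList_iff I).2 h)⟩, fun h => h.1⟩

end Phase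

/-! ### Progress of a set in a phase -/

section Progress

variable (p : Params) (I : SetCoverInstance)

/-- The number of uncovered elements of `S` at the start of phase `k`. -/
noncomputable def numUnc (ρ : ℕ → ℕ → ℕ → ℕ) (S k : ℕ) : ℝ :=
  ∑ e ∈ (I.setList S).toFinset, ind (Unc p I ρ e (k * p.T))

/-- A discounted sum of the numbers of uncovered elements in the phases up to `k`. -/
noncomputable def discounted (ρ : ℕ → ℕ → ℕ → ℕ) (S : ℕ) : ℕ → ℝ
  | 0 => numUnc p I ρ S 0
  | k + 1 => discounted ρ S k / 4 + numUnc p I ρ S (k + 1)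

/-- `S` counts as large in phase `k` if it has more than a small fraction of `scale` active
elements. -/
noncomputable def scale (ρ : ℕ → ℕ → ℕ → ℕ) (S k : ℕ) : ℝ :=
  2 ^ p.L / 2 ^ k + 2 * discounted p I ρ S k

variable {p I} {ρ : ℕ → ℕ → ℕ → ℕ} {S : ℕ}

theorem numUnc_nonneg (k : ℕ) : 0 ≤ numUnc p I ρ S k := Finset.sum_nonneg fun _ _ => ind_nonneg _

theorem numUnc_le_discounted (k : ℕ) : numUnc p I ρ S k ≤ discounted p I ρ S k ∧
    0 ≤ discounted p I ρ S k := by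
  induction k with
  | zero => exact ⟨le_rfl, numUnc_nonneg 0⟩
  | succ k ih =>
    have := numUnc_nonneg (p := p) (I := I) (ρ := ρ) (S := S) (k + 1)
    simp only [discounted]
    constructor <;> linarith [ih.2]

theorem numUnc_le (hΔ : ∀ S, (I.setList S).length ≤ 2 ^ p.L) (k : ℕ) :
    numUnc p I ρ S k ≤ 2 ^ p.L := by
  have h1 : numUnc p I ρ S k ≤ ∑ e ∈ (I.setList S).toFinset, 1 :=
    Finset.sum_le_sum fun _ _ => ind_le_one _
  refine h1.trans ?_
  rw [Finset.sum_const, nsmul_eq_mul, mul_one]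
  exact_mod_cast (List.toFinset_card_le _).trans (hΔ S)

theorem discounted_le (hΔ : ∀ S, (I.setList S).length ≤ 2 ^ p.L) (k : ℕ) :
    discounted p I ρ S k ≤ 2 * 2 ^ p.L := by
  induction k with
  | zero =>
    have := numUnc_le (ρ := ρ) (S := S) hΔ 0
    simp only [discounted]
    linarith [show (0 : ℝ) ≤ 2 ^ p.L by positivity]
  | succ k ih =>
    have := numUnc_le (ρ := ρ) (S := S) hΔ (k + 1)
    simp only [discounted]
    linarith [show (0 : ℝ) ≤ 2 ^ p.L by positivity]

theorem numAct_le_numUnc {k t : ℕ} : numAct p I ρ S (k * p.T + t) ≤ numUnc p I ρ S k :=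
  Finset.sum_le_sum fun _ _ => ind_mono fun h => h.unc.mono (Nat.le_add_right _ _)

/-- The factor `4` per round absorbs the history: inside a phase `2 + 1 ≤ 4`, and at the start of
the next phase `1 + 1 = 4 * (2 * (1 / 4))`. The extra factor `2` at `t = 0` thus pays for the
discount `1 / 4` between phases. -/
theorem totalWeight_le_aux {k t : ℕ} (ht : t < p.T) :
    totalWeight p I ρ S (k * p.T + t) ≤
      4 ^ (k * p.T + t) * ((if t = 0 then 2 else 1) * discounted p I ρ S k) := by
  have hstep : ∀ k t, totalWeight p I ρ S (k * p.T + t + 1) ≤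
      totalWeight p I ρ S (k * p.T + t) + 4 ^ (k * p.T + t) * discounted p I ρ S k := by
    intro k t
    unfold totalWeight
    rw [Finset.sum_range_succ]
    gcongr
    exact numAct_le_numUnc.trans (numUnc_le_discounted k).1
  have hin : ∀ k, totalWeight p I ρ S (k * p.T) ≤ 4 ^ (k * p.T) * (2 * discounted p I ρ S k) →
      ∀ t, t < p.T → totalWeight p I ρ S (k * p.T + t) ≤
      4 ^ (k * p.T + t) * ((if t = 0 then 2 else 1) * discounted p I ρ S k) := by
    intro k hk t
    induction t with
    | zero => intro _; simpa using hk
    | succ t ih =>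
      intro ht
      have h1 := hstep k t
      have h2 := ih (by omega)
      have h3 := (numUnc_le_discounted (p := p) (I := I) (ρ := ρ) (S := S) k).2
      have h4 : (if t = 0 then (2 : ℝ) else 1) ≤ 2 := by split_ifs <;> norm_num
      have h5 : (4 : ℝ) ^ (k * p.T + (t + 1)) = 4 * 4 ^ (k * p.T + t) := by ring
      have h6 : (0 : ℝ) < 4 ^ (k * p.T + t) := by positivity
      rw [← add_assoc] at h5 ⊢
      rw [if_neg (Nat.succ_ne_zero t), h5]
      have h7 : (4 : ℝ) ^ (k * p.T + t) * ((if t = 0 then 2 else 1) * discounted p I ρ S k) ≤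
          4 ^ (k * p.T + t) * (2 * discounted p I ρ S k) := by gcongr
      nlinarith [mul_nonneg h6.le h3]
  have hstart : ∀ k, totalWeight p I ρ S (k * p.T) ≤ 4 ^ (k * p.T) * (2 * discounted p I ρ S k) := by
    intro k
    induction k with
    | zero =>
      have := (numUnc_le_discounted (p := p) (I := I) (ρ := ρ) (S := S) 0).2
      simp only [zero_mul, totalWeight, Finset.range_zero, Finset.sum_empty]
      positivity
    | succ k ih =>
      obtain ⟨t, ht⟩ : ∃ t, p.T = t + 2 := ⟨p.T - 2, by unfold Params.T; omega⟩
      have h1 := hin k ih (t + 1) (by omega)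
      have h2 := hstep k (t + 1)
      have h3 := (numUnc_le_discounted (p := p) (I := I) (ρ := ρ) (S := S) k).2
      have h4 := numUnc_nonneg (p := p) (I := I) (ρ := ρ) (S := S) (k + 1)
      have h5 : k * p.T + (t + 1) + 1 = (k + 1) * p.T := by
        rw [add_mul, one_mul]
        omega
      have h6 : (4 : ℝ) ^ ((k + 1) * p.T) = 4 * 4 ^ (k * p.T + (t + 1)) := by rw [← h5]; ring
      rw [h5] at h2
      rw [h6, discounted]
      rw [if_neg (Nat.succ_ne_zero t)] at h1
      have h7 : (0 : ℝ) < 4 ^ (k * p.T + (t + 1)) := by positivity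
      nlinarith [mul_nonneg h7.le h4]
  exact hin k (hstart k) t ht

theorem scale_pos (k : ℕ) : 0 < scale p I ρ S k := by
  have := (numUnc_le_discounted (p := p) (I := I) (ρ := ρ) (S := S) k).2
  unfold scale
  positivity

theorem totalWeight_le {k t : ℕ} (ht : t < p.T) :
    totalWeight p I ρ S (k * p.T + t) ≤ 4 ^ (k * p.T + t) * scale p I ρ S k := by
  refine (totalWeight_le_aux ht).trans ?_
  have := (numUnc_le_discounted (p := p) (I := I) (ρ := ρ) (S := S) k).2
  gcongr
  unfold scale
  have h2 : (0 : ℝ) < 2 ^ p.L / 2 ^ k := by positivity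
  split_ifs <;> linarith

theorem pow_one_sub_le_inv {x : ℝ} (h0 : 0 ≤ x) (h1 : x ≤ 1) (m : ℕ) :
    (1 - x) ^ m ≤ (1 + m * x)⁻¹ := by
  have := prod_one_sub_le_inv (Finset.range m) (fun _ => x) (fun _ _ => h0) fun _ _ => h1
  simpa using this

theorem slots_eq {k t : ℕ} (ht : t < p.T) :
    (p.slots (k * p.T + t) : ℝ) = 2048 * 2 ^ p.B / (2 ^ p.L / 2 ^ k) := by
  have h1 : (k * p.T + t) / p.T = k := by
    rw [add_comm, Nat.add_mul_div_right _ _ p.T_pos, Nat.div_eq_of_lt ht, zero_add]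
  unfold Params.slots
  rw [h1]
  push_cast
  have h2 : (2 : ℝ) ^ p.B = 2 ^ (p.B - p.L) * 2 ^ p.L := by
    rw [← pow_add, Nat.sub_add_cancel (by unfold Params.B; omega)]
  rw [h2, pow_add]
  field_simp

/-- A large set passes its test with high probability. -/
theorem one_sub_hp_le_of_large (hΔ : ∀ S, (I.setList S).length ≤ 2 ^ p.L) (hS : S < I.numSets)
    {k t : ℕ} (hk : k ≤ p.L) (ht : t < p.T)
    (hlarge : scale p I ρ S k / 32 ≤ numAct p I ρ S (k * p.T + t)) :
    1 - hp p I ρ (k * p.T + t) S ≤ 1 / 16 := by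
  set n := k * p.T + t with hn
  set W := scale p I ρ S k with hW
  have hW0 : 0 < W := scale_pos k
  have hLB : (2 : ℝ) ^ p.L ≤ 2 ^ p.B :=
    pow_le_pow_right₀ (by norm_num) (by unfold Params.B; omega)
  have hB : (I.setList S).length ≤ 2 ^ p.B :=
    (hΔ S).trans (Nat.pow_le_pow_right (by norm_num) (by unfold Params.B; omega))
  have hL0 : (0 : ℝ) < 2 ^ p.L := by positivity
  have hB0 : (0 : ℝ) < 2 ^ p.B := by positivity
  have hWle : W ≤ 5 * 2 ^ p.B := by
    have h1 := discounted_le (ρ := ρ) (S := S) hΔ k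
    have h2 : (2 : ℝ) ^ p.L / 2 ^ k ≤ 2 ^ p.L :=
      div_le_self hL0.le (one_le_pow₀ (by norm_num))
    rw [hW]
    unfold scale
    linarith
  have hWge : (2 : ℝ) ^ p.L / 2 ^ k ≤ W := by
    have := (numUnc_le_discounted (p := p) (I := I) (ρ := ρ) (S := S) k).2
    rw [hW]
    unfold scale
    linarith
  -- With about `x` slots the expected work is at most `2048 * 4 ^ n`, which is `budget n / 32`. At
  -- least `x / 2` slots and `W / 32` active elements give at least `32` expected hits, so all slots
  -- miss with probability at most `1 / 33`. Enough slots exist because `W ≥ 2 ^ L / 2 ^ k`.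
  set x : ℝ := 2048 * 2 ^ p.B / W with hx
  have hxW : x * W = 2048 * 2 ^ p.B := by rw [hx]; field_simp
  have hx1 : 2 ≤ x := by
    rw [hx, le_div_iff₀ hW0]
    linarith
  set m := ⌊x⌋₊ with hm
  have hmx : (m : ℝ) ≤ x := Nat.floor_le (by linarith)
  have hmx' : x / 2 ≤ m := by
    have := Nat.lt_floor_add_one x
    rw [← hm] at this
    linarith
  have hms : m ≤ p.slots n := by
    have : (m : ℝ) ≤ p.slots n := by
      refine hmx.trans ?_
      rw [hn, slots_eq ht, hx]
      gcongr
    exact_mod_cast this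
  have hmain := one_sub_hp_le p I ρ hS (phase_lt_rounds p hk ht) hB hms
  refine hmain.trans ?_
  have hact : numAct p I ρ S n ≤ 2 ^ p.B :=
    (numAct_le_numUnc.trans (numUnc_le hΔ k)).trans hLB
  have h1 : (1 - numAct p I ρ S n / 2 ^ p.B) ^ m ≤ 1 / 33 := by
    refine (pow_one_sub_le_inv (div_nonneg (numAct_nonneg p I ρ) hB0.le)
      ((div_le_one hB0).2 hact) m).trans ?_
    rw [inv_eq_one_div]
    have h2 : 32 ≤ m * (numAct p I ρ S n / 2 ^ p.B) := by
      rw [mul_div_assoc', le_div_iff₀ hB0]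
      have h3 : x / 2 * (W / 32) ≤ m * numAct p I ρ S n := by gcongr
      have h4 : x / 2 * (W / 32) = 32 * 2 ^ p.B := by linarith
      linarith
    refine one_div_le_one_div_of_le (by norm_num) (by linarith)
  have h2 : m * (totalWeight p I ρ S n / 2 ^ p.B) / budget n ≤ 1 / 32 := by
    have hb : (0 : ℝ) < budget n := by unfold budget; positivity
    rw [div_le_iff₀ hb, mul_div_assoc', div_le_iff₀ hB0]
    have h3 : m * totalWeight p I ρ S n ≤ x * (4 ^ n * W) := by
      have h4 : totalWeight p I ρ S n ≤ 4 ^ n * W := totalWeight_le ht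
      have h5 : 0 ≤ 4 ^ n * W := by positivity
      calc _ ≤ m * (4 ^ n * W) := by gcongr
        _ ≤ _ := by gcongr
    refine h3.trans (le_of_eq ?_)
    unfold budget
    push_cast
    rw [show x * (4 ^ n * W) = 4 ^ n * (x * W) by ring, hxW]
    ring
  linarith

end Progress
end SparseGreedy

namespace SparseGreedy

/-! ### Decay of the number of uncovered elements of a set. -/

section Progress

variable {p : Params} {I : SetCoverInstance}

theorem numUnc_splice (ρ : ℕ → ℕ → ℕ → ℕ) {n k : ℕ} (r : RoundSample p I) (S : ℕ)
    (hk : k * p.T ≤ n) : numUnc p I (splice ρ n r) S k = numUnc p I ρ S k := by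
  unfold numUnc
  simp only [unc_splice p I ρ r _ hk]

theorem discounted_splice (ρ : ℕ → ℕ → ℕ → ℕ) {n k : ℕ} (r : RoundSample p I) (S : ℕ)
    (hk : k * p.T ≤ n) : discounted p I (splice ρ n r) S k = discounted p I ρ S k := by
  induction k with
  | zero => exact numUnc_splice ρ r S hk
  | succ k ih =>
    simp only [discounted]
    rw [ih ((Nat.mul_le_mul_right _ (Nat.le_succ k)).trans hk), numUnc_splice ρ r S hk]

theorem scale_splice (ρ : ℕ → ℕ → ℕ → ℕ) {n k : ℕ} (r : RoundSample p I) (S : ℕ)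
    (hk : k * p.T ≤ n) : scale p I (splice ρ n r) S k = scale p I ρ S k := by
  unfold scale
  rw [discounted_splice ρ r S hk]

variable (p I) in
/-- The weight of `S` as long as it is large in phase `k`. -/
noncomputable def largeWeight (ρ : ℕ → ℕ → ℕ → ℕ) (S k n : ℕ) : ℝ :=
  numUnc p I ρ S k * (ind (scale p I ρ S k / 32 ≤ numAct p I ρ S n) * 2 ^ ex p I ρ S n)

/-- A large set passes its test with probability at least `15 / 16`, so `2 ^ ex` changes by the
expected factor `4 - 7 / 2 * (15 / 16) < 3 / 4`. Active elements only disappear within a phase, so a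
set that is no longer large stays so. -/
theorem expect_largeWeight_le (hΔ : ∀ S, (I.setList S).length ≤ 2 ^ p.L)
    (ρ : ℕ → ℕ → ℕ → ℕ) (S : Fin I.numSets) {k t : ℕ} (hk : k ≤ p.L) (ht : t + 1 < p.T) :
    𝔼 r : RoundSample p I,
      largeWeight p I (splice ρ (k * p.T + t) r) S k (k * p.T + t + 1) ≤
      3 / 4 * largeWeight p I ρ S k (k * p.T + t) := by
  set n := k * p.T + t with hn
  have hmod : (n + 1) % p.T ≠ 0 := phase_succ_mod p ht
  have hkn : k * p.T ≤ n := Nat.le_add_right _ _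
  have hU := numUnc_nonneg (p := p) (I := I) (ρ := ρ) (S := S) k
  have hmono : ∀ r : RoundSample p I,
      numAct p I (splice ρ n r) S (n + 1) ≤ numAct p I ρ S n := fun r =>
    Finset.sum_le_sum fun e _ => ind_mono fun h =>
      (act_splice p I ρ r e le_rfl).1 (h.of_succ hmod).1
  unfold largeWeight
  simp only [numUnc_splice ρ _ _ hkn, scale_splice ρ _ _ hkn]
  rw [← Finset.mul_expect, mul_left_comm]
  refine mul_le_mul_of_nonneg_left ?_ hU
  by_cases hlarge : scale p I ρ S k / 32 ≤ numAct p I ρ S n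
  swap
  · rw [ind_of_not hlarge, zero_mul, mul_zero]
    refine le_of_eq (Finset.expect_eq_zero fun r _ => ?_)
    rw [ind_of_not, zero_mul]
    exact fun h => hlarge (h.trans (hmono r))
  rw [ind_of hlarge, one_mul]
  have hhp := one_sub_hp_le_of_large hΔ S.2 hk (by omega : t < p.T) hlarge
  have hpt : ∀ r : RoundSample p I,
      ind (scale p I ρ S k / 32 ≤ numAct p I (splice ρ n r) S (n + 1)) *
        2 ^ ex p I (splice ρ n r) S (n + 1) ≤
      2 ^ ex p I ρ S n * (4 - 7 / 2 * ind (test p I ρ n S (r S) = true)) := by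
    intro r
    rw [ex_succ_splice p I ρ hmod]
    by_cases h : test p I ρ n S (r S) = true
    · rw [if_pos h, ind_of h]
      -- At exponent `0` a success cannot halve `2 ^ ex`. But then `S` volunteers surely and joins,
      -- no element of it stays active, and the indicator vanishes.
      rcases Nat.eq_zero_or_pos (ex p I ρ S n) with h0 | h0
      · rw [ind_of_not, zero_mul]
        · norm_num
        · have : numAct p I (splice ρ n r) S (n + 1) = 0 := by
            refine Finset.sum_eq_zero fun e he => ind_of_not fun hact => ?_
            refine (hact.of_succ hmod).2 S ((mem_setList_iff I).1 (List.mem_toFinset.1 he)) ?_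
            rw [joined_splice, h0]
            exact ⟨by simp, h⟩
          rw [this, not_le]
          have := scale_pos (p := p) (I := I) (ρ := ρ) (S := S) k
          positivity
      · obtain ⟨a, ha⟩ : ∃ a, ex p I ρ S n = a + 1 := ⟨ex p I ρ S n - 1, by omega⟩
        rw [ha, Nat.add_sub_cancel, pow_succ]
        have h1 := ind_le_one (scale p I ρ S k / 32 ≤ numAct p I (splice ρ n r) S (n + 1))
        have h2 : (0 : ℝ) < 2 ^ a := by positivity
        nlinarith
    · rw [if_neg h, ind_of_not h, pow_add]
      have h1 := ind_le_one (scale p I ρ S k / 32 ≤ numAct p I (splice ρ n r) S (n + 1))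
      have h2 : (0 : ℝ) < 2 ^ ex p I ρ S n := by positivity
      nlinarith
  refine (expect_mono hpt).trans ?_
  rw [← Finset.mul_expect, Finset.expect_sub_distrib, ← Finset.mul_expect,
    expect_eval S (fun ξ : SetSample p => ind (test p I ρ n S ξ = true)), Fintype.expect_const,
    mul_comm (3 / 4 : ℝ)]
  change _ * (4 - 7 / 2 * hp p I ρ n S) ≤ _
  refine mul_le_mul_of_nonneg_left ?_ (by positivity)
  linarith

/-- The expected number of uncovered elements of a set is halved in each phase. -/
theorem EE_numUnc_succ_le (hΔ : ∀ S, (I.setList S).length ≤ 2 ^ p.L)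
    (hf : ∀ e, (I.elemList e).length ≤ 2 ^ p.F) (S : Fin I.numSets) {k : ℕ} (hk : k ≤ p.L) :
    EE p I (fun ρ => numUnc p I ρ S (k + 1)) ≤ EE p I (fun ρ => scale p I ρ S k) / 32 +
      (1 / 8 + 46 / 2 ^ 16) * EE p I fun ρ => numUnc p I ρ S k := by
  obtain ⟨t, ht⟩ : ∃ t, p.T = t + 1 := ⟨p.T - 1, by have := p.T_pos; omega⟩
  have htF : t = 4 * p.F + 8 := by unfold Params.T at ht; omega
  have hlast : k * p.T + t ≤ (k + 1) * p.T := by rw [add_mul, one_mul]; omega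
  -- An element still uncovered was active in the last round or stalled. The active ones are few
  -- unless `S` is still large, and in that case `2 ^ ex ≥ 1` lets `largeWeight` dominate them.
  have hpt : ∀ ρ, numUnc p I ρ S (k + 1) ≤ scale p I ρ S k / 32 +
      (largeWeight p I ρ S k (k * p.T + t) +
      ∑ e ∈ (I.setList S).toFinset, ∑ s ∈ Finset.range p.T,
        ind (Stalls p I ρ e (k * p.T + s))) := by
    intro ρ
    have h1 : numUnc p I ρ S (k + 1) ≤ numAct p I ρ S (k * p.T + t) +
        ∑ e ∈ (I.setList S).toFinset, ∑ s ∈ Finset.range p.T,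
          ind (Stalls p I ρ e (k * p.T + s)) := by
      unfold numUnc numAct
      rw [← Finset.sum_add_distrib]
      refine Finset.sum_le_sum fun e _ => ?_
      have h0 : 0 ≤ ∑ s ∈ Finset.range p.T, ind (Stalls p I ρ e (k * p.T + s)) :=
        Finset.sum_nonneg fun _ _ => ind_nonneg _
      by_cases hu : Unc p I ρ e ((k + 1) * p.T)
      · rcases (hu.mono hlast).act_or_stalls (by omega) with h | ⟨s, hs, h⟩
        · rw [ind_of hu, ind_of h]; linarith
        · have := Finset.single_le_sum (f := fun s => ind (Stalls p I ρ e (k * p.T + s)))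
            (fun _ _ => ind_nonneg _) (Finset.mem_range.2 (show s < p.T by omega))
          have h2 := ind_nonneg (Act p I ρ e (k * p.T + t))
          rw [ind_of hu]
          simp only [ind_of h] at this
          linarith
      · rw [ind_of_not hu]
        have h2 := ind_nonneg (Act p I ρ e (k * p.T + t))
        linarith
    have h2 : numAct p I ρ S (k * p.T + t) ≤ scale p I ρ S k / 32 +
        largeWeight p I ρ S k (k * p.T + t) := by
      have hW := scale_pos (p := p) (I := I) (ρ := ρ) (S := S) k
      have hU := numUnc_nonneg (p := p) (I := I) (ρ := ρ) (S := S) k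
      unfold largeWeight
      by_cases h : scale p I ρ S k / 32 ≤ numAct p I ρ S (k * p.T + t)
      · rw [ind_of h, one_mul]
        have h3 : numAct p I ρ S (k * p.T + t) ≤ numUnc p I ρ S k := numAct_le_numUnc
        have h4 : (1 : ℝ) ≤ 2 ^ ex p I ρ S (k * p.T + t) := one_le_pow₀ (by norm_num)
        nlinarith
      · rw [ind_of_not h, zero_mul, mul_zero]
        linarith
    linarith
  have hlw : ∀ s ≤ t, EE p I (fun ρ => largeWeight p I ρ S k (k * p.T + s)) ≤
      (3 / 4) ^ s * (2 ^ p.F * EE p I fun ρ => numUnc p I ρ S k) := by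
    intro s
    induction s with
    | zero =>
      intro _
      rw [pow_zero, one_mul, ← EE_mul_left]
      refine EE_mono p I fun ρ => ?_
      have hU := numUnc_nonneg (p := p) (I := I) (ρ := ρ) (S := S) k
      unfold largeWeight
      have h1 : ex p I ρ S (k * p.T + 0) = p.F := expo_of_mod_eq_zero p _ (by simp) S
      rw [h1, mul_comm]
      refine mul_le_mul_of_nonneg_right ?_ hU
      exact mul_le_of_le_one_left (by positivity) (ind_le_one _)
    | succ s ih =>
      intro hs
      have h1 := EE_le_of_round p I (phase_lt_rounds p hk (by omega : s < p.T))
        (φ := fun ρ => largeWeight p I ρ S k (k * p.T + s + 1))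
        (ψ := fun ρ => 3 / 4 * largeWeight p I ρ S k (k * p.T + s))
        fun ρ => expect_largeWeight_le hΔ ρ S hk (by omega : s + 1 < p.T)
      rw [EE_mul_left] at h1
      have h2 := ih (by omega)
      rw [← add_assoc, pow_succ]
      linarith
  -- This fixes the length of a phase: four rounds outweigh one doubling, as `(3 / 4) ^ 4 * 2 < 1`,
  -- and eight more give the factor `1 / 8`.
  have h34 : (3 / 4 : ℝ) ^ t * 2 ^ p.F ≤ 1 / 8 := by
    rw [htF, pow_add, pow_mul]
    calc ((3 / 4 : ℝ) ^ 4) ^ p.F * (3 / 4) ^ 8 * 2 ^ p.F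
        = ((3 / 4 : ℝ) ^ 4 * 2) ^ p.F * (3 / 4) ^ 8 := by rw [mul_pow]; ring
      _ ≤ 1 * (1 / 8) := by
          refine mul_le_mul (pow_le_one₀ (by positivity) (by norm_num)) (by norm_num)
            (by positivity) (by norm_num)
      _ = _ := by ring
  have hU : 0 ≤ EE p I fun ρ => numUnc p I ρ S k := EE_nonneg p I fun ρ => numUnc_nonneg k
  have h1 := EE_mono p I hpt
  simp only [div_eq_inv_mul (scale _ _ _ _ _)] at h1
  rw [EE_add, EE_add, EE_mul_left, EE_sum] at h1
  have h2 := hlw t le_rfl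
  have h3 : (3 / 4 : ℝ) ^ t * (2 ^ p.F * EE p I fun ρ => numUnc p I ρ S k) ≤
      1 / 8 * EE p I fun ρ => numUnc p I ρ S k := by
    rw [← mul_assoc]
    gcongr
  have h4 : ∑ e ∈ (I.setList S).toFinset, EE p I (fun ρ => ∑ s ∈ Finset.range p.T,
      ind (Stalls p I ρ e (k * p.T + s))) ≤ 46 / 2 ^ 16 * EE p I fun ρ => numUnc p I ρ S k := by
    unfold numUnc
    rw [EE_sum, Finset.mul_sum]
    refine Finset.sum_le_sum fun e _ => ?_
    rw [EE_sum]
    exact sum_stalls_le p I hf hk e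
  linarith

theorem EE_numUnc_le (hΔ : ∀ S, (I.setList S).length ≤ 2 ^ p.L)
    (hf : ∀ e, (I.elemList e).length ≤ 2 ^ p.F) (S : Fin I.numSets) {k : ℕ} (hk : k ≤ p.L + 1) :
    EE p I (fun ρ => numUnc p I ρ S k) ≤ 2 ^ p.L / 2 ^ k ∧
      EE p I (fun ρ => discounted p I ρ S k) ≤ 2 * (2 ^ p.L / 2 ^ k) := by
  induction k with
  | zero =>
    have h1 : EE p I (fun ρ => numUnc p I ρ S 0) ≤ 2 ^ p.L := by
      refine (EE_mono p I fun ρ => numUnc_le hΔ 0).trans ?_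
      rw [EE_const]
    simp only [discounted, pow_zero, div_one]
    exact ⟨h1, by linarith [show (0 : ℝ) ≤ 2 ^ p.L by positivity]⟩
  | succ k ih =>
    obtain ⟨h1, h2⟩ := ih (by omega)
    have h3 := EE_numUnc_succ_le hΔ hf S (by omega : k ≤ p.L)
    have h4 : EE p I (fun ρ => scale p I ρ S k) =
        2 ^ p.L / 2 ^ k + 2 * EE p I (fun ρ => discounted p I ρ S k) := by
      unfold scale
      rw [EE_add, EE_const, EE_mul_left]
    have h5 : (2 : ℝ) ^ p.L / 2 ^ (k + 1) = 2 ^ p.L / 2 ^ k / 2 := by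
      rw [pow_succ]; field_simp
    have h6 : EE p I (fun ρ => discounted p I ρ S (k + 1)) =
        EE p I (fun ρ => discounted p I ρ S k) / 4 + EE p I fun ρ => numUnc p I ρ S (k + 1) := by
      simp only [discounted, div_eq_inv_mul]
      rw [EE_add, EE_mul_left]
    have h7 : (0 : ℝ) < 2 ^ p.L / 2 ^ k := by positivity
    rw [h5, h6]
    -- The expectation of `scale` is at most `5 * 2 ^ L / 2 ^ k`, and `5 / 32 + 1 / 8 + 46 / 2 ^ 16
    -- < 1 / 2`.
    have h8 : EE p I (fun ρ => numUnc p I ρ S (k + 1)) ≤ 2 ^ p.L / 2 ^ k / 2 := by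
      rw [h4] at h3
      norm_num at h3
      linarith
    exact ⟨h8, by linarith⟩

/-! ### The size of the cover -/

/-- The expected number of uncovered elements at the start of phase `k`. -/
theorem EE_unc_le (hΔ : ∀ S, (I.setList S).length ≤ 2 ^ p.L)
    (hf : ∀ e, (I.elemList e).length ≤ 2 ^ p.F) {𝒞 : Finset (Fin I.numSets)} (h𝒞 : I.IsCover 𝒞)
    {k : ℕ} (hk : k ≤ p.L + 1) :
    ∑ e ∈ Finset.range I.numElems, EE p I (fun ρ => ind (Unc p I ρ e (k * p.T))) ≤
      𝒞.card * (2 ^ p.L / 2 ^ k) := by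
  have h1 : ∑ S ∈ 𝒞, EE p I (fun ρ => numUnc p I ρ S k) ≤ 𝒞.card * (2 ^ p.L / 2 ^ k) := by
    rw [← nsmul_eq_mul]
    exact Finset.sum_le_card_nsmul _ _ _ fun S _ => (EE_numUnc_le hΔ hf S hk).1
  refine le_trans ?_ h1
  rw [← EE_sum, ← EE_sum]
  refine EE_mono p I fun ρ => ?_
  unfold numUnc
  rw [Finset.sum_comm' (s' := fun e => 𝒞.filter fun S : Fin I.numSets => e ∈ I.setList S)
    (t' := Finset.range I.numElems)]
  · refine Finset.sum_le_sum fun e he => ?_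
    obtain ⟨S, hS, heS⟩ := h𝒞 ⟨e, Finset.mem_range.1 he⟩
    refine Finset.single_le_sum (f := fun _ => ind (Unc p I ρ e (k * p.T)))
      (fun _ _ => ind_nonneg _) (Finset.mem_filter.2 ⟨hS, ?_⟩ : S ∈ _)
    rw [SetCoverInstance.setList, dif_pos S.2, List.mem_map]
    exact ⟨_, heS, rfl⟩
  · intro S e
    simp only [List.mem_toFinset, Finset.mem_filter, Finset.mem_range]
    exact ⟨fun h => ⟨h, setList_lt I h.2⟩, fun h => h.1⟩

/-- The expected number of sets that are assigned to elements is within a logarithmic factor of the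
size of any cover. -/
theorem EE_card_le (hΔ : ∀ S, (I.setList S).length ≤ 2 ^ p.L)
    (hf : ∀ e, (I.elemList e).length ≤ 2 ^ p.F) {𝒞 : Finset (Fin I.numSets)} (h𝒞 : I.IsCover 𝒞) :
    EE p I (fun ρ => (((Finset.range I.numElems).image (assign p I ρ)).card : ℝ)) ≤
      (23 * 2048 * (p.L + 1) + 1) * 𝒞.card := by
  classical
  have hpt : ∀ ρ, (((Finset.range I.numElems).image (assign p I ρ)).card : ℝ) ≤
      ∑ n ∈ Finset.range p.rounds, ∑ S : Fin I.numSets, ind (Joined p I ρ n S) +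
      ∑ e ∈ Finset.range I.numElems, ind (Unc p I ρ e p.rounds) := by
    intro ρ
    set J := (Finset.range p.rounds).biUnion fun n =>
      (Finset.univ.filter fun S : Fin I.numSets => Joined p I ρ n S).image Fin.val with hJ
    set U := (Finset.range I.numElems).filter fun e => Unc p I ρ e p.rounds with hU
    -- An assigned set either joined in some round or is the default choice of an element left
    -- uncovered.
    have hsub : (Finset.range I.numElems).image (assign p I ρ) ⊆ J ∪ U.image (assign p I ρ) := by
      intro S hS
      obtain ⟨e, he, rfl⟩ := Finset.mem_image.1 hS
      rw [Finset.mem_union]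
      by_cases hu : Unc p I ρ e p.rounds
      · exact .inr (Finset.mem_image_of_mem _ (Finset.mem_filter.2 ⟨he, hu⟩))
      · left
        have hmem := assign_mem (p := p) (ρ := ρ) (Finset.mem_range.1 he)
        have : ∃ n < p.rounds, Joined p I ρ n (assign p I ρ e) := by
          unfold Unc at hu
          rw [assign_eq]
          cases hs : stat p I ρ e p.rounds with
          | covered S => exact (exists_joined_of_covered hs).2
          | active => rw [hs] at hu; simp [ElemStatus.isUncovered] at hu
          | stalled => rw [hs] at hu; simp [ElemStatus.isUncovered] at hu
        obtain ⟨n, hn, hj⟩ := this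
        refine Finset.mem_biUnion.2 ⟨n, Finset.mem_range.2 hn, Finset.mem_image.2
          ⟨⟨_, elemList_lt I hmem⟩, ?_, rfl⟩⟩
        simpa using hj
    have hind : ∀ P : Prop, ind P = if P then 1 else 0 := fun P => by
      by_cases h : P <;> simp [ind, h]
    have h1 : (J.card : ℝ) ≤
        ∑ n ∈ Finset.range p.rounds, ∑ S : Fin I.numSets, ind (Joined p I ρ n S) := by
      have : J.card ≤ ∑ n ∈ Finset.range p.rounds,
          (Finset.univ.filter fun S : Fin I.numSets => Joined p I ρ n S).card :=
        Finset.card_biUnion_le.trans (Finset.sum_le_sum fun n _ => Finset.card_image_le)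
      refine (Nat.cast_le.2 this).trans (le_of_eq ?_)
      simp only [hind, Finset.sum_boole, Nat.cast_sum]
    have h2 : ((U.image (assign p I ρ)).card : ℝ) ≤
        ∑ e ∈ Finset.range I.numElems, ind (Unc p I ρ e p.rounds) := by
      refine (Nat.cast_le.2 Finset.card_image_le).trans (le_of_eq ?_)
      rw [hU, Finset.card_filter, Nat.cast_sum]
      refine Finset.sum_congr rfl fun e _ => ?_
      by_cases h : Unc p I ρ e p.rounds <;> simp [ind, h]
    have h3 := (Finset.card_le_card hsub).trans (Finset.card_union_le _ _)
    have h4 : (((Finset.range I.numElems).image (assign p I ρ)).card : ℝ) ≤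
      J.card + (U.image (assign p I ρ)).card := by exact_mod_cast h3
    linarith
  refine (EE_mono p I hpt).trans ?_
  rw [EE_add, EE_sum, EE_sum]
  have hlast : ∑ e ∈ Finset.range I.numElems, EE p I (fun ρ => ind (Unc p I ρ e p.rounds)) ≤
      𝒞.card := by
    have h1 := EE_unc_le hΔ hf h𝒞 (le_refl (p.L + 1))
    refine h1.trans ?_
    have : (2 : ℝ) ^ p.L / 2 ^ (p.L + 1) ≤ 1 := by
      rw [div_le_one (by positivity)]
      exact pow_le_pow_right₀ (by norm_num) (by omega)
    nlinarith [show (0 : ℝ) ≤ 𝒞.card by positivity]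
  have hphase : ∀ K ≤ p.L + 1, ∑ n ∈ Finset.range (K * p.T),
      EE p I (fun ρ => ∑ S : Fin I.numSets, ind (Joined p I ρ n S)) ≤
      23 * 2048 * K * 𝒞.card := by
    intro K
    induction K with
    | zero => intro _; simp
    | succ k ih =>
      intro hk
      rw [add_mul, one_mul, Finset.sum_range_add]
      have h1 := ih (by omega)
      have h2 : ∑ t ∈ Finset.range p.T,
          EE p I (fun ρ => ∑ S : Fin I.numSets, ind (Joined p I ρ (k * p.T + t) S)) ≤
          23 * 2048 * 𝒞.card := by
        have hkL : k ≤ p.L := by omega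
        -- The price per unit of load is inverse to the bound on uncovered elements per member of
        -- `𝒞`, so the phase index cancels and every phase costs the same.
        calc _ ≤ ∑ t ∈ Finset.range p.T, 2048 / (2 ^ p.L / 2 ^ k) *
              ∑ e ∈ Finset.range I.numElems, load p I e (k * p.T + t) := by
              refine Finset.sum_le_sum fun t ht => ?_
              have ht := Finset.mem_range.1 ht
              refine (EE_joined_le p I hΔ (phase_lt_rounds p hkL ht)).trans (le_of_eq ?_)
              rw [slots_eq ht]
              congr 1
              field_simp
          _ = 2048 / (2 ^ p.L / 2 ^ k) * ∑ e ∈ Finset.range I.numElems,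
              ∑ t ∈ Finset.range p.T, load p I e (k * p.T + t) := by
              rw [← Finset.mul_sum, Finset.sum_comm]
          _ ≤ 2048 / (2 ^ p.L / 2 ^ k) * (23 * (𝒞.card * (2 ^ p.L / 2 ^ k))) := by
              gcongr
              refine (Finset.sum_le_sum fun e _ => sum_load_le p I hf hkL e).trans ?_
              rw [← Finset.mul_sum]
              gcongr
              exact EE_unc_le hΔ hf h𝒞 (by omega)
          _ = _ := by field_simp
      push_cast
      linarith
  have h1 := hphase (p.L + 1) le_rfl
  push_cast at h1
  have h2 : Finset.range p.rounds = Finset.range ((p.L + 1) * p.T) := rfl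
  rw [h2]
  linarith

end Progress
end SparseGreedy

namespace SparseGreedy

/-! ### The law of the random numbers -/

open MeasureTheory in
instance : IsProbabilityMeasure randomString := by
  unfold randomString
  infer_instance

open MeasureTheory in
theorem randomString_cylinder {K : Type*} [Fintype K] {κ : K → ℕ} (hκ : Function.Injective κ)
    (y : K → Bool) : randomString {ω | ω ∘ κ = y} = (2⁻¹ : ENNReal) ^ Fintype.card K := by
  classical
  have h1 : {ω : ℕ → Bool | ω ∘ κ = y} =
      Set.pi ((Finset.univ.image κ : Finset ℕ) : Set ℕ) fun i => {b | ∀ k, κ k = i → b = y k} := by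
    ext ω
    simp only [Set.mem_ofPred_eq, Set.mem_pi, Finset.coe_image, Finset.coe_univ, Set.image_univ,
      Set.mem_range, forall_exists_index, forall_apply_eq_imp_iff, funext_iff, Function.comp_apply]
    constructor
    · intro h k k' hk
      rw [← hκ hk]
      exact h k'
    · intro h k
      exact h k k rfl
  rw [h1, randomString, Measure.infinitePi_pi _ fun i _ => MeasurableSet.of_discrete,
    Finset.prod_image fun _ _ _ _ h => hκ h]
  have h2 : ∀ k, (PMF.uniformOfFintype Bool).toMeasure {b | ∀ k', κ k' = κ k → b = y k'} =
      2⁻¹ := by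
    intro k
    have : {b | ∀ k', κ k' = κ k → b = y k'} = {y k} := by
      ext b
      simp only [Set.mem_ofPred_eq, Set.mem_singleton_iff]
      exact ⟨fun h => h k rfl, fun h k' hk => by rw [h, hκ hk]⟩
    rw [this, PMF.toMeasure_apply_singleton _ _ (MeasurableSet.of_discrete)]
    simp
  simp [h2]

open MeasureTheory in
theorem integral_randomString_comp {K : Type*} [Fintype K] [DecidableEq K] {κ : K → ℕ}
    (hκ : Function.Injective κ) (G : (K → Bool) → ℝ) :
    Integrable (fun ω => G (ω ∘ κ)) randomString ∧
      ∫ ω, G (ω ∘ κ) ∂randomString = 𝔼 y, G y := by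
  have hm : Measurable fun ω : ℕ → Bool => ω ∘ κ :=
    measurable_pi_lambda _ fun k => measurable_pi_apply _
  have hG : Measurable G := Measurable.of_discrete
  have : IsProbabilityMeasure (randomString.map fun ω : ℕ → Bool => ω ∘ κ) :=
    Measure.isProbabilityMeasure_map hm.aemeasurable
  have hint : Integrable G (randomString.map fun ω : ℕ → Bool => ω ∘ κ) := Integrable.of_finite
  refine ⟨hint.comp_measurable hm, ?_⟩
  have h1 := integral_map hm.aemeasurable (f := G) hG.aestronglyMeasurable (μ := randomString)
  rw [← h1, integral_fintype hint, Fintype.expect_eq_sum_div_card, Finset.sum_div]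
  refine Finset.sum_congr rfl fun y _ => ?_
  have h2 : (randomString.map fun ω : ℕ → Bool => ω ∘ κ).real {y} = (2⁻¹ : ℝ) ^ Fintype.card K := by
    rw [Measure.real, Measure.map_apply hm (MeasurableSet.singleton y)]
    have : (fun ω : ℕ → Bool => ω ∘ κ) ⁻¹' {y} = {ω | ω ∘ κ = y} := rfl
    rw [this, randomString_cylinder hκ]
    simp
  rw [h2]
  simp [div_eq_inv_mul]

section Law

variable (p : Params) (I : SetCoverInstance)

/-- The indices of the random bits that the process reads. -/
abbrev BitIndex : Type :=
  Fin p.rounds × Fin I.numSets × Fin (p.slots p.rounds + 1) × Fin p.B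

/-- Their places in the random string. -/
def bitPlace (k : BitIndex p I) : ℕ := bitKey k.1 k.2.1 k.2.2.1 k.2.2.2

theorem bitPlace_injective : Function.Injective (bitPlace p I) := by
  rintro ⟨n, S, i, b⟩ ⟨n', S', i', b'⟩ h
  simp only [bitPlace, bitKey, Nat.pair_eq_pair] at h
  obtain ⟨h1, h2, h3, h4⟩ := h
  simp [Fin.ext_iff, h1, h2, h3, h4]

/-- Random bits and random numbers correspond to each other. -/
def bitsEquiv : (BitIndex p I → Bool) ≃ Sample p I where
  toFun y n S i := finFunctionFinEquiv fun b => finTwoEquiv.symm (y (n, S, i, b))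
  invFun x k := finTwoEquiv (finFunctionFinEquiv.symm (x k.1 k.2.1 k.2.2.1) k.2.2.2)
  left_inv y := by
    funext ⟨n, S, i, b⟩
    simp
  right_inv x := by
    funext n S i
    simp

theorem agree_bitsEquiv (ω : ℕ → Bool) :
    Agree p I p.rounds (numbers p.B ω) (bitsEquiv p I (ω ∘ bitPlace p I)).val := by
  intro n hn S hS i hi
  have hi' : i < p.slots p.rounds + 1 := by
    have := slots_mono p hn.le
    omega
  simp only [Sample.val, hn, RoundSample.val, hS, SetSample.val, hi', dif_pos, bitsEquiv,
    Equiv.coe_fn_mk, finFunctionFinEquiv_apply, numbers]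
  rw [← Fin.sum_univ_eq_sum_range (fun b => (ω (bitKey n S i b)).toNat * 2 ^ b)]
  refine Finset.sum_congr rfl fun b _ => ?_
  congr 1
  simp only [Function.comp_apply, bitPlace]
  cases ω (bitKey n S i b) <;> rfl

-- Only finitely many bits influence `φ`, at distinct places of the random string, so the integral
-- is a uniform average over a finite cube.
open MeasureTheory in
theorem integral_numbers (φ : (ℕ → ℕ → ℕ → ℕ) → ℝ)
    (hφ : ∀ ρ ρ', Agree p I p.rounds ρ ρ' → φ ρ = φ ρ') :
    Integrable (fun ω => φ (numbers p.B ω)) randomString ∧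
      ∫ ω, φ (numbers p.B ω) ∂randomString = EE p I φ := by
  have h1 : ∀ ω, φ (numbers p.B ω) = φ (bitsEquiv p I (ω ∘ bitPlace p I)).val := fun ω =>
    hφ _ _ (agree_bitsEquiv p I ω)
  simp only [h1]
  have h2 := integral_randomString_comp (bitPlace_injective p I)
    fun y => φ (bitsEquiv p I y).val
  refine ⟨h2.1, h2.2.trans ?_⟩
  exact Fintype.expect_equiv (bitsEquiv p I) _ _ fun y => rfl

theorem assign_congr {ρ ρ' : ℕ → ℕ → ℕ → ℕ} (h : Agree p I p.rounds ρ ρ') (e : ℕ) :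
    assign p I ρ e = assign p I ρ' e := by
  rw [assign_eq, assign_eq, stat_congr p I ρ h]

end Law
end SparseGreedy

namespace SetCoverLCA

/-! ### Algorithms that assign a set to each element -/

/-- Does one of the `k` elements of `S` from position `i` on choose `S`? -/
def chosenProc (a : ℕ → ProbeProc ℕ) (S : ℕ) : ℕ → ℕ → ProbeProc Bool
  | 0, _ => .ret false
  | k + 1, i => .probe (.set S) i fun
    | none => .ret false
    | some e => (a e).bind fun S' => if S' = S then .ret true else chosenProc a S k (i + 1)

/-- Each element `e` chooses the set `a e`; a set belongs to the cover if one of its first `w`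
elements chooses it. -/
def ofAssign (w : ℕ) (a : ℕ → ProbeProc ℕ) : SetCoverLCA where
  setQuery S := chosenProc a S w 0
  elemQuery := a

variable (I : SetCoverInstance) (ω : ℕ → Bool)

theorem output_chosenProc (a : ℕ → ProbeProc ℕ) (S k i : ℕ) :
    (chosenProc a S k i).output I ω = true ↔
      ∃ e ∈ ((I.setList S).drop i).take k, (a e).output I ω = S := by
  induction k generalizing i with
  | zero => simp [chosenProc]
  | succ k ih =>
    simp only [chosenProc, ProbeProc.output_probe, I.oracle_set]
    by_cases hi : i < (I.setList S).length
    · rw [List.getElem?_eq_getElem hi, List.drop_eq_getElem_cons hi, List.take_succ_cons]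
      simp only [ProbeProc.output_bind, List.exists_mem_cons_iff]
      split_ifs with h
      · simp [h]
      · simp [h, ih]
    · rw [List.getElem?_eq_none (by omega), List.drop_eq_nil_of_le (by omega)]
      simp

theorem numProbes_chosenProc_le {a : ℕ → ProbeProc ℕ} {X : ℕ}
    (ha : ∀ e, (a e).numProbes I ω ≤ X) (S k i : ℕ) :
    (chosenProc a S k i).numProbes I ω ≤ k * (X + 1) := by
  induction k generalizing i with
  | zero => simp [chosenProc]
  | succ k ih =>
    simp only [chosenProc, ProbeProc.numProbes_probe, I.oracle_set]
    cases (I.setList S)[i]? with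
    | none => simp only [ProbeProc.numProbes_ret]; nlinarith
    | some e =>
      simp only [ProbeProc.numProbes_bind]
      have h1 := ha e
      have h2 := ih (i + 1)
      split_ifs
      · simp only [ProbeProc.numProbes_ret]; nlinarith
      · nlinarith

theorem mem_cover_ofAssign {w : ℕ} {a : ℕ → ProbeProc ℕ} {S : Fin I.numSets} :
    S ∈ (ofAssign w a).cover I ω ↔
      ∃ e ∈ (I.setList S).take w, (a e).output I ω = S := by
  have h := output_chosenProc I ω a S w 0
  rw [List.drop_zero] at h
  rw [cover, Finset.mem_filter]
  exact ⟨fun h' => h.1 h'.2, fun h' => ⟨Finset.mem_univ _, h.2 h'⟩⟩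

end SetCoverLCA

/-! ### Degree bounds and an optimal cover. -/

namespace SetCoverInstance

variable (I : SetCoverInstance)

theorem mem_setList {S : Fin I.numSets} {e : Fin I.numElems} :
    (e : ℕ) ∈ I.setList S ↔ e ∈ I.setAdj S := by
  rw [setList, dif_pos S.2, List.mem_map]
  exact ⟨fun ⟨a, ha, h⟩ => Fin.ext h ▸ ha, fun h => ⟨e, h, rfl⟩⟩

theorem length_setList_le {Δ : ℕ} (h : I.maxSetSize ≤ Δ) (S : ℕ) :
    (I.setList S).length ≤ Δ := by
  unfold setList
  split_ifs with hS
  · rw [List.length_map]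
    exact (Finset.le_sup (f := fun S : Fin I.numSets => (I.setAdj S).length)
      (Finset.mem_univ _)).trans h
  · simp

theorem length_elemList_le {f : ℕ} (h : I.maxFreq ≤ f) (e : ℕ) :
    (I.elemList e).length ≤ f := by
  unfold elemList
  split_ifs with he
  · rw [List.length_map]
    exact (Finset.le_sup (f := fun e : Fin I.numElems => (I.elemAdj e).length)
      (Finset.mem_univ _)).trans h
  · simp

theorem exists_isCover_card_eq_opt : ∃ 𝒞 : Finset (Fin I.numSets), I.IsCover 𝒞 ∧ 𝒞.card = I.opt :=
  Nat.sInf_mem (s := {k | ∃ 𝒞 : Finset (Fin I.numSets), I.IsCover 𝒞 ∧ 𝒞.card = k})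
    ⟨_, Finset.univ, fun e => (I.exists_mem e).imp fun S hS => ⟨Finset.mem_univ S, hS⟩, rfl⟩

end SetCoverInstance

theorem SetCoverLCA.isCover_of_consistent {A : SetCoverLCA} {I : SetCoverInstance} {ω : ℕ → Bool}
    (h : ∀ e : Fin I.numElems, ∃ S ∈ A.cover I ω,
      (A.elemQuery e).output I ω = S ∧ e ∈ I.setAdj S) : I.IsCover (A.cover I ω) :=
  fun e => (h e).imp fun _ hS => ⟨hS.1, hS.2.2⟩

/-! ### Instances with singletons or with disjoint sets -/

namespace FirstSet

open SetCoverInstance SparseGreedy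

/-- Each element chooses the first set that contains it. -/
def firstProc (e : ℕ) : ProbeProc ℕ := .probe (.elem e) 0 fun o => .ret (o.getD 0)

/-- Only the first element of a set can choose it. -/
def lca : SetCoverLCA := .ofAssign 1 firstProc

variable (I : SetCoverInstance) (ω : ℕ → Bool)

theorem output_firstProc (e : ℕ) :
    (firstProc e).output I ω = (I.elemList e).headD 0 := by
  simp [firstProc, I.oracle_elem, List.headD_eq_head?_getD, List.head?_eq_getElem?]

theorem eq_of_mem_of_length_le_one {l : List ℕ} (h : l.length ≤ 1) {a b : ℕ} (ha : a ∈ l)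
    (hb : b ∈ l) : a = b := by
  match l, h with
  | [c], _ => simp_all

theorem headD_mem {l : List ℕ} {a : ℕ} (h : a ∈ l) : l.headD 0 ∈ l := by
  cases l with
  | nil => simp at h
  | cons b l => simp

theorem mem_cover {S : Fin I.numSets} : S ∈ lca.cover I ω ↔
    ∃ e ∈ (I.setList S).take 1, (I.elemList e).headD 0 = S := by
  rw [lca, SetCoverLCA.mem_cover_ofAssign]
  simp only [output_firstProc]

variable {I}

theorem consistent (h : I.maxSetSize ≤ 1 ∨ I.maxFreq ≤ 1) (e : Fin I.numElems) :
    ∃ S ∈ lca.cover I ω, (lca.elemQuery e).output I ω = S ∧ e ∈ I.setAdj S := by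
  obtain ⟨S₀, hS₀⟩ := List.exists_mem_of_ne_nil _ (elemList_ne_nil I e.2)
  have hmem := headD_mem hS₀
  set S := (I.elemList e).headD 0 with hS
  have hlt := elemList_lt I hmem
  have he : (e : ℕ) ∈ I.setList S := (mem_setList_iff I).2 hmem
  refine ⟨⟨S, hlt⟩, ?_, output_firstProc I ω e, (I.mem_setList (S := ⟨S, hlt⟩)).1 he⟩
  rw [mem_cover]
  rcases h with h | h
  · refine ⟨e, ?_, rfl⟩
    rw [List.take_of_length_le (I.length_setList_le h S)]
    exact he
  · obtain ⟨e', l, hl⟩ : ∃ e' l, I.setList S = e' :: l := List.exists_cons_of_ne_nil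
      (List.ne_nil_of_mem he)
    have h1 : S ∈ I.elemList e' := (mem_setList_iff I).1 (by rw [hl]; simp)
    refine ⟨e', by simp [hl], ?_⟩
    exact eq_of_mem_of_length_le_one (I.length_elemList_le h e') (headD_mem h1) h1

/-- Send a chosen set to a member of `𝒞` that contains an element choosing it. If sets are
singletons, the image determines that element and hence its choice; if frequencies are at most one,
the image is the set itself. -/
theorem card_cover_le (h : I.maxSetSize ≤ 1 ∨ I.maxFreq ≤ 1) {𝒞 : Finset (Fin I.numSets)}
    (h𝒞 : I.IsCover 𝒞) : (lca.cover I ω).card ≤ 𝒞.card := by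
  have key : ∀ S ∈ lca.cover I ω, ∃ T ∈ 𝒞, ∃ e, e ∈ I.setList S ∧ e ∈ I.setList T ∧
      (I.elemList e).headD 0 = S := by
    intro S hS
    obtain ⟨e, he, h1⟩ := (mem_cover I ω).1 hS
    have he := List.mem_of_mem_take he
    obtain ⟨T, hT, heT⟩ := h𝒞 ⟨e, setList_lt I he⟩
    exact ⟨T, hT, e, he, I.mem_setList.2 heT, h1⟩
  choose! t ht e heS heT hh using key
  refine Finset.card_le_card_of_injOn t ht fun S hS S' hS' hSS => ?_
  rcases h with h | h
  · have h1 := heT S hS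
    have h2 := heT S' hS'
    rw [hSS] at h1
    have := eq_of_mem_of_length_le_one (I.length_setList_le h _) h1 h2
    apply Fin.ext
    rw [← hh S hS, ← hh S' hS', this]
  · have h1 : ∀ S ∈ lca.cover I ω, (S : ℕ) = t S := fun S hS =>
      eq_of_mem_of_length_le_one (I.length_elemList_le h (e S))
        ((mem_setList_iff I).1 (heS S hS)) ((mem_setList_iff I).1 (heT S hS))
    apply Fin.ext
    rw [h1 S hS, h1 S' hS', hSS]

variable (I)

theorem numProbes_setQuery_le (S : ℕ) : (lca.setQuery S).numProbes I ω ≤ 2 :=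
  SetCoverLCA.numProbes_chosenProc_le I ω (X := 1) (fun e => by simp [firstProc]) S 1 0

theorem numProbes_elemQuery_le (e : ℕ) : (lca.elemQuery e).numProbes I ω ≤ 2 := by
  simp [lca, SetCoverLCA.ofAssign, firstProc]

theorem cover_eq (ω' : ℕ → Bool) : lca.cover I ω = lca.cover I ω' := by
  ext S
  rw [mem_cover, mem_cover]

end FirstSet

/-! ### The main algorithm -/

namespace SparseGreedy

/-- The parameters for set sizes up to `Δ` and frequencies up to `f`. -/
def params (Δ f : ℕ) : Params := ⟨Nat.clog 2 Δ, Nat.clog 2 f⟩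

/-- The algorithm for set sizes up to `Δ` and frequencies up to `f`. -/
def lca (Δ f : ℕ) : SetCoverLCA := .ofAssign Δ (assignProc (params Δ f) f)

variable {Δ f : ℕ} {I : SetCoverInstance}

theorem mem_cover (hΔ : I.maxSetSize ≤ Δ) (hf : I.maxFreq ≤ f) (ω : ℕ → Bool)
    {S : Fin I.numSets} : S ∈ (lca Δ f).cover I ω ↔
      ∃ e ∈ I.setList S, assign (params Δ f) I (numbers (params Δ f).B ω) e = S := by
  rw [lca, SetCoverLCA.mem_cover_ofAssign, List.take_of_length_le (I.length_setList_le hΔ S)]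
  simp only [output_assignProc _ _ _ _ (I.length_elemList_le hf)]

theorem consistent (hΔ : I.maxSetSize ≤ Δ) (hf : I.maxFreq ≤ f) (ω : ℕ → Bool)
    (e : Fin I.numElems) : ∃ S ∈ (lca Δ f).cover I ω,
      ((lca Δ f).elemQuery e).output I ω = S ∧ e ∈ I.setAdj S := by
  have hmem := assign_mem (p := params Δ f) (ρ := numbers (params Δ f).B ω) e.2
  have he := (mem_setList_iff I).2 hmem
  refine ⟨⟨_, elemList_lt I hmem⟩, (mem_cover hΔ hf ω).2 ⟨e, he, rfl⟩, ?_, I.mem_setList.1 he⟩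
  exact output_assignProc _ _ _ _ (I.length_elemList_le hf) e

open MeasureTheory in
theorem integral_card_cover_le (hΔ : I.maxSetSize ≤ Δ) (hf : I.maxFreq ≤ f) :
    Integrable (fun ω => (((lca Δ f).cover I ω).card : ℝ)) randomString ∧
    ∫ ω, (((lca Δ f).cover I ω).card : ℝ) ∂randomString ≤
      (23 * 2048 * (Nat.clog 2 Δ + 1) + 1) * I.opt := by
  classical
  set p := params Δ f with hp
  have hΔ' : ∀ S, (I.setList S).length ≤ 2 ^ p.L := fun S =>
    (I.length_setList_le hΔ S).trans (Nat.le_pow_clog (by norm_num) _)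
  have hf' : ∀ e, (I.elemList e).length ≤ 2 ^ p.F := fun e =>
    (I.length_elemList_le hf e).trans (Nat.le_pow_clog (by norm_num) _)
  let φ : (ℕ → ℕ → ℕ → ℕ) → ℝ := fun ρ =>
    ((Finset.univ.filter fun S : Fin I.numSets => ∃ e ∈ I.setList S, assign p I ρ e = S).card : ℝ)
  have hφ : ∀ ω, (((lca Δ f).cover I ω).card : ℝ) = φ (numbers p.B ω) := by
    intro ω
    have : (lca Δ f).cover I ω = Finset.univ.filter fun S : Fin I.numSets =>
        ∃ e ∈ I.setList S, assign p I (numbers p.B ω) e = S := by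
      ext S
      rw [mem_cover hΔ hf]
      simp [hp]
    rw [this]
  have hint := integral_numbers p I φ fun ρ ρ' h => by
    simp only [φ, assign_congr p I h]
  simp only [hφ]
  refine ⟨hint.1, hint.2.trans_le ?_⟩
  obtain ⟨𝒞, h𝒞, hcard⟩ := I.exists_isCover_card_eq_opt
  rw [← hcard]
  refine le_trans (EE_mono p I fun ρ => ?_) (EE_card_le hΔ' hf' h𝒞)
  simp only [φ]
  norm_cast
  refine Finset.card_le_card_of_injOn Fin.val ?_ Fin.val_injective.injOn
  intro S hS
  have hS := Finset.mem_coe.1 hS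
  obtain ⟨e, he, h1⟩ := (Finset.mem_filter.1 hS).2
  rw [Finset.mem_coe]
  exact Finset.mem_image.2 ⟨e, Finset.mem_range.2 (setList_lt I he), h1⟩

theorem numProbes_assignProc_le_pow (hf : I.maxFreq ≤ f) (ω : ℕ → Bool) (e : ℕ) :
    (assignProc (params Δ f) f e).numProbes I ω + 1 ≤
      2 ^ (36 * (params Δ f).rounds + (params Δ f).B + 32) := by
  set p := params Δ f with hp
  have h1 := numProbes_assignProc_le p f I ω (I.length_elemList_le hf) e
  have hF : f ≤ 2 ^ p.B := (Nat.le_pow_clog (b := 2) (by norm_num) f).trans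
    (Nat.pow_le_pow_right (by norm_num) (show p.F ≤ p.B by unfold Params.B; omega))
  have h2 : baseCost p f ≤ 2 ^ 13 * 2 ^ p.B := by unfold baseCost; omega
  have h3 : 4 ^ p.rounds * ((2 ^ 16 + 3) * (baseCost p f * growth ^ p.rounds)) ≤
      2 ^ (36 * p.rounds + p.B + 30) := by
    calc _ ≤ 4 ^ p.rounds * (2 ^ 17 * (2 ^ 13 * 2 ^ p.B * growth ^ p.rounds)) := by
          gcongr
          norm_num
      _ = _ := by
          unfold growth
          rw [show (4 : ℕ) = 2 ^ 2 by norm_num, ← pow_mul, ← pow_mul, ← pow_add, ← pow_add,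
            ← pow_add, ← pow_add]
          congr 1
          ring
  have h4 : 1 ≤ 2 ^ (36 * p.rounds + p.B + 30) := Nat.one_le_two_pow
  have h5 : 2 ^ (36 * p.rounds + p.B + 32) = 4 * 2 ^ (36 * p.rounds + p.B + 30) := by
    rw [show 36 * p.rounds + p.B + 32 = (36 * p.rounds + p.B + 30) + 2 by ring, pow_add]
    ring
  omega

theorem numProbes_setQuery_le (hf : I.maxFreq ≤ f) (ω : ℕ → Bool) (S : ℕ) :
    ((lca Δ f).setQuery S).numProbes I ω ≤
      2 ^ (36 * (params Δ f).rounds + (params Δ f).B + 32 + (params Δ f).L) := by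
  set p := params Δ f with hp
  have h1 : ∀ e, (assignProc p f e).numProbes I ω ≤ 2 ^ (36 * p.rounds + p.B + 32) - 1 := fun e =>
    Nat.le_sub_of_add_le (numProbes_assignProc_le_pow hf ω e)
  have h2 := SetCoverLCA.numProbes_chosenProc_le I ω h1 S Δ 0
  rw [Nat.sub_add_cancel Nat.one_le_two_pow] at h2
  refine h2.trans ?_
  rw [pow_add 2 (36 * p.rounds + p.B + 32), mul_comm]
  exact Nat.mul_le_mul_left _ (Nat.le_pow_clog (by norm_num) _)

theorem one_le_logb_and_clog_le {m : ℕ} (hm : 2 ≤ m) :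
    1 ≤ Real.logb 2 m ∧ (Nat.clog 2 m : ℝ) ≤ Real.logb 2 m + 1 := by
  have h1 : 1 ≤ Real.logb 2 m := by
    rw [Real.le_logb_iff_rpow_le (by norm_num) (by positivity)]
    simpa using hm
  refine ⟨h1, ?_⟩
  have h2 := Real.natCeil_logb_natCast 2 m
  have h3 := (Nat.ceil_lt_add_one (by linarith : 0 ≤ Real.logb 2 m)).le
  rw [← h2]
  exact_mod_cast h3

/-- For `Δ, f ≥ 2` both logarithms are at least `1`, so the linear and constant terms are absorbed
by their product. -/
theorem exponent_le (hΔ : 2 ≤ Δ) (hf : 2 ≤ f) :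
    ((36 * (params Δ f).rounds + (params Δ f).B + 32 + (params Δ f).L : ℕ) : ℝ) ≤
      100000 * (1 + Real.logb 2 Δ * Real.logb 2 f) := by
  obtain ⟨h1, h2⟩ := one_le_logb_and_clog_le hΔ
  obtain ⟨h3, h4⟩ := one_le_logb_and_clog_le hf
  simp only [params, Params.rounds, Params.B, Params.T]
  push_cast
  set x := Real.logb 2 Δ
  set y := Real.logb 2 f
  set L : ℝ := (Nat.clog 2 Δ : ℝ)
  set F : ℝ := (Nat.clog 2 f : ℝ)
  have hL0 : 0 ≤ L := Nat.cast_nonneg _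
  have hF0 : 0 ≤ F := Nat.cast_nonneg _
  have h5 : (L + 1) * (4 * F + 9) ≤ (x + 2) * (4 * y + 13) := by
    refine mul_le_mul ?_ ?_ ?_ ?_ <;> linarith
  have h6 : 0 ≤ (x - 1) * (y - 1) := mul_nonneg (by linarith) (by linarith)
  nlinarith

end SparseGreedy

/-! ### The theorem from the two cases. -/

/-- Sparsified greedy, except for singletons or disjoint sets, where the first set is good enough. -/
def setCoverLCA (Δ f : ℕ) : SetCoverLCA :=
  if Δ ≤ 1 ∨ f ≤ 1 then FirstSet.lca else SparseGreedy.lca Δ f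

theorem theorem1p1 :
    ∃ (A : ℕ → ℕ → SetCoverLCA) (C : ℝ), ∀ Δ f : ℕ, 1 ≤ Δ → 1 ≤ f →
      ∀ I : SetCoverInstance, I.maxSetSize ≤ Δ → I.maxFreq ≤ f →
        -- for every random string, the answers to all queries are consistent with one cover
        (∀ ω : ℕ → Bool,
          I.IsCover ((A Δ f).cover I ω) ∧
          ∀ e : Fin I.numElems, ∃ S ∈ (A Δ f).cover I ω,
            ((A Δ f).elemQuery e).output I ω = S ∧ e ∈ I.setAdj S) ∧
        -- for every random string, each query is answered with few probes
        (∀ ω : ℕ → Bool,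
          (∀ S : Fin I.numSets, (((A Δ f).setQuery S).numProbes I ω : ℝ) ≤
            2 ^ (C * (1 + Real.logb 2 Δ * Real.logb 2 f))) ∧
          ∀ e : Fin I.numElems, (((A Δ f).elemQuery e).numProbes I ω : ℝ) ≤
            2 ^ (C * (1 + Real.logb 2 Δ * Real.logb 2 f))) ∧
        -- the cover is `O(log Δ)`-approximate in expectation
        MeasureTheory.Integrable (fun ω => (((A Δ f).cover I ω).card : ℝ)) randomString ∧
        ∫ ω, (((A Δ f).cover I ω).card : ℝ) ∂randomString ≤
          C * (1 + Real.logb 2 Δ) * I.opt := by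
  refine ⟨setCoverLCA, 100000, fun Δ f hΔ1 hf1 I hΔ hf => ?_⟩
  have hx : 0 ≤ Real.logb 2 Δ := Real.logb_nonneg (by norm_num) (by exact_mod_cast hΔ1)
  have hy : 0 ≤ Real.logb 2 f := Real.logb_nonneg (by norm_num) (by exact_mod_cast hf1)
  have hopt : (0 : ℝ) ≤ I.opt := Nat.cast_nonneg _
  by_cases h : Δ ≤ 1 ∨ f ≤ 1
  · rw [setCoverLCA, if_pos h]
    have h' : I.maxSetSize ≤ 1 ∨ I.maxFreq ≤ 1 := h.imp hΔ.trans hf.trans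
    have hpow : (2 : ℝ) ≤ 2 ^ ((100000 : ℝ) * (1 + Real.logb 2 Δ * Real.logb 2 f)) := by
      conv_lhs => rw [← Real.rpow_one 2]
      refine Real.rpow_le_rpow_of_exponent_le (by norm_num) ?_
      nlinarith [mul_nonneg hx hy]
    have hcov : ∀ ω, FirstSet.lca.cover I ω = FirstSet.lca.cover I fun _ => true := fun ω =>
      FirstSet.cover_eq I ω _
    refine ⟨fun ω => ⟨SetCoverLCA.isCover_of_consistent (FirstSet.consistent ω h'),
      FirstSet.consistent ω h'⟩, fun ω => ⟨fun S => le_trans ?_ hpow, fun e => le_trans ?_ hpow⟩, ?_⟩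
    · exact_mod_cast FirstSet.numProbes_setQuery_le I ω S
    · exact_mod_cast FirstSet.numProbes_elemQuery_le I ω e
    · simp only [hcov]
      refine ⟨MeasureTheory.integrable_const _, ?_⟩
      obtain ⟨𝒞, h𝒞, hcard⟩ := I.exists_isCover_card_eq_opt
      have h1 := FirstSet.card_cover_le (fun _ => true) h' h𝒞
      rw [hcard] at h1
      have h2 : ((FirstSet.lca.cover I fun _ => true).card : ℝ) ≤ I.opt := by exact_mod_cast h1
      simp only [MeasureTheory.integral_const, MeasureTheory.probReal_univ, one_smul]
      nlinarith [mul_nonneg hx hopt]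
  · rw [setCoverLCA, if_neg h]
    have hΔ2 : 2 ≤ Δ := by omega
    have hf2 : 2 ≤ f := by omega
    have hpow : ∀ N : ℕ, N ≤ 2 ^ (36 * (SparseGreedy.params Δ f).rounds +
        (SparseGreedy.params Δ f).B + 32 + (SparseGreedy.params Δ f).L) →
        (N : ℝ) ≤ 2 ^ ((100000 : ℝ) * (1 + Real.logb 2 Δ * Real.logb 2 f)) := by
      intro N hN
      have h1 : (N : ℝ) ≤ (2 : ℝ) ^ (36 * (SparseGreedy.params Δ f).rounds +
        (SparseGreedy.params Δ f).B + 32 + (SparseGreedy.params Δ f).L) := by exact_mod_cast hN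
      rw [← Real.rpow_natCast] at h1
      exact h1.trans (Real.rpow_le_rpow_of_exponent_le (by norm_num)
        (SparseGreedy.exponent_le hΔ2 hf2))
    have hcons := SparseGreedy.consistent hΔ hf
    obtain ⟨hint, hle⟩ := SparseGreedy.integral_card_cover_le hΔ hf
    refine ⟨fun ω => ⟨SetCoverLCA.isCover_of_consistent (hcons ω), hcons ω⟩, fun ω =>
      ⟨fun S => hpow _ (SparseGreedy.numProbes_setQuery_le hf ω S), fun e => hpow _ ?_⟩, hint,
      hle.trans ?_⟩
    · have h1 := SparseGreedy.numProbes_assignProc_le_pow (Δ := Δ) hf ω e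
      refine ((Nat.le_succ _).trans h1).trans (Nat.pow_le_pow_right (by norm_num) (by omega))
    · refine mul_le_mul_of_nonneg_right ?_ hopt
      have h1 := (SparseGreedy.one_le_logb_and_clog_le hΔ2).2
      linarith
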